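/- Let $N,s\ge 1$ be integers. There is a constant $C(N,s)>0$, depending only on $N$ and $s$, such that the following holds. Let $n_1,\dots,n_N\ge 1$ be integers, let $w_1,\dots,w_N>0$ be real numbers, and let $F_1,\dots,F_N$ and $G_1,\dots,G_N$ be probability distributions on $\mathbb{Z}$. Let $X_{ij},Z_{ij}$ ($1\le i\le N$, $1\le j\le n_i$) be mutually independent integer-valued random variables such that, for each $i$, every $X_{ij}$ has distribution $F_i$ and every $Z_{ij}$ has distribution $G_i$. Put $$S=\sum_{i=1}^N w_i\sum_{j=1}^{n_i}X_{ij},\qquad Z=\sum_{i=1}^N w_i\sum_{j=1}^{n_i}Z_{ij}.$$ For a distribution $F$ on $\mathbb{Z}$ and $k\ge1$ let $$\nu_k^{\pm}(F)=\sum_{m=k}^\infty m(m-1)\cdots(m-k+1)\,F\{\pm m\}\in[0,\infty],\qquad \beta_k^{\pm}(F,G)=\nu_k^{\pm}(F)+\nu_k^{\pm}(G).$$ Let $I_a$ be the unit mass at $a$, $I=I_0$, let products of measures be convolutions and let $\|\cdot\|$ be the total variation norm. Set $$u_i=\min\Bigl\{1-\tfrac12\|F_i(I_1-I)\|,\ 1-\tfrac12\|G_i(I_1-I)\|\Bigr\}.$$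 Assume that, for all $i=1,\dots,N$, $$u_i>0,\qquad n_iu_i\ge 1,\qquad \nu_k^{+}(F_i)=\nu_k^{+}(G_i),\quad \nu_k^{-}(F_i)=\nu_k^{-}(G_i)\quad(k=1,\dots,s),\qquad \beta_{s+1}^{+}(F_i,G_i)+\beta_{s+1}^{-}(F_i,G_i)<\infty .$$ Then $$\sup_{x\in\mathbb{R}}\bigl|P(S\le x)-P(Z\le x)\bigr|\le C(N,s)\,\frac{\max_j w_j}{\min_j w_j}\Bigl(\sum_{i=1}^N n_iu_i\Bigr)^{-1/2}\sum_{i=1}^N\frac{\beta_{s+1}^{+}(F_i,G_i)+\beta_{s+1}^{-}(F_i,G_i)}{n_i^{s/2-1}u_i^{s/2}} .$$ -/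

import Mathlib

open MeasureTheory ProbabilityTheory
open scoped ENNReal

/-- The Kolmogorov (uniform) norm `sup_x |M((-∞, x])|` of a finite signed measure on the line.
Signed measures are bounded, so the supremum is that of a bounded family. -/
noncomputable def kolmogorovNorm (M : SignedMeasure ℝ) : ℝ :=
  ⨆ x : ℝ, |M (Set.Iic x)|

/-- The total variation norm `‖M‖ = M⁺(ℤ) + M⁻(ℤ)` (Jordan-Hahn decomposition). -/
noncomputable def tvNorm (M : SignedMeasure ℤ) : ℝ :=
  (M.totalVariation Set.univ).toReal

/-- Right-hand side factorial moment
`ν_k⁺(F) = ∑_{m ≥ k} m (m - 1) ⋯ (m - k + 1) F{m}`, with values in `[0, ∞]`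
(`m.descFactorial k = 0` for `m < k`). -/
noncomputable def nuPlus (k : ℕ) (F : Measure ℤ) : ℝ≥0∞ :=
  ∑' m : ℕ, (m.descFactorial k : ℝ≥0∞) * F {(m : ℤ)}

/-- Left-hand side factorial moment
`ν_k⁻(F) = ∑_{m ≥ k} m (m - 1) ⋯ (m - k + 1) F{-m}`, with values in `[0, ∞]`. -/
noncomputable def nuMinus (k : ℕ) (F : Measure ℤ) : ℝ≥0∞ :=
  ∑' m : ℕ, (m.descFactorial k : ℝ≥0∞) * F {-(m : ℤ)}

/-- `β_k⁺(F, G) = ν_k⁺(F) + ν_k⁺(G)`. -/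
noncomputable def betaPlus (k : ℕ) (F G : Measure ℤ) : ℝ≥0∞ :=
  nuPlus k F + nuPlus k G

/-- `β_k⁻(F, G) = ν_k⁻(F) + ν_k⁻(G)`. -/
noncomputable def betaMinus (k : ℕ) (F G : Measure ℤ) : ℝ≥0∞ :=
  nuMinus k F + nuMinus k G

/-- The signed measure `F (I_1 - I)`: products are convolutions, `I_a` is the unit mass at `a`
and `I = I_0`. -/
noncomputable def shiftDiff (F : Measure ℤ) [IsFiniteMeasure F] : SignedMeasure ℤ :=
  (Measure.conv F (Measure.dirac 1)).toSignedMeasure -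
    (Measure.conv F (Measure.dirac 0)).toSignedMeasure

/-- `u = min {1 - ‖F (I_1 - I)‖ / 2, 1 - ‖G (I_1 - I)‖ / 2}`. -/
noncomputable def uMin (F G : Measure ℤ) [IsFiniteMeasure F] [IsFiniteMeasure G] : ℝ :=
  min (1 - tvNorm (shiftDiff F) / 2) (1 - tvNorm (shiftDiff G) / 2)

/-- The weighted sum `∑_i w_i ∑_j X_{ij}`. -/
noncomputable def weightedSum {Ω : Type*} {N : ℕ} {n : Fin N → ℕ} (w : Fin N → ℝ)
    (X : (i : Fin N) → Fin (n i) → Ω → ℤ) (ω : Ω) : ℝ :=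
  ∑ i, w i * ∑ j, (X i j ω : ℝ)

/-!
Discrete measures on the line act by convolution on bounded functions, and their convolution
operators lie in a commutative Banach algebra `ShiftAlg` in which the operator norm is at most the
total variation norm. If `e` is the indicator function of `(-∞, 0]` and `T` the operator of the law
of `S`, then `P(S ≤ x) = (T e)(-x)`, so the Kolmogorov distance is at most `‖(T_S - T_Z) e‖`, where
`T_S = ∏ a_i ^ n_i`, `T_Z = ∏ b_i ^ n_i` and `a_i`, `b_i` are the operators of `F_i`, `G_i` scaled by
`w_i`. Write `t_i` for the translation by `w_i`.

* Matching of the one-sided factorial moments up to order `s` gives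
  `a_i - b_i = (t_i - 1) ^ (s + 1) M_i` with `‖M_i‖ ≤ β_{s+1}⁺ + β_{s+1}⁻`, by Taylor expansion of
  `t ^ m` at `t = 1` (`exists_laurent_sub_laurent`).
* A law `F` on `ℤ` is a mixture, with weight its overlap `∑ min (F{k}, F{k + 1})`, of a law that has a
  symmetric Bernoulli factor, and of another law (`exists_laurent_eq_mixture`); the overlap is at
  least `1 - ‖F (I₁ - I)‖ / 2`. Hence a product of such laws is a mixture over random subsets `J` of
  products with `|J|` symmetric Bernoulli factors, and `E (1 + |J|)^(-1/2)` is of the order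
  `(1 + E |J|)^(-1/2)` (`norm_prod_smul_le_of_mixture`). It suffices to smooth with Bernoulli factors.
* In total variation, `‖(t - 1) ((1 + t) / 2) ^ r‖ ≤ 2 / √(r + 1)`, by the variance of the binomial
  law. In the uniform norm, `∏ (1 + t_j) / 2` applied to `(t_i - 1) e` counts subset sums in an
  interval of length `w_i`, and Sperner's theorem bounds it by `2 (w_i / min w) / √(r + 1)` (the
  Littlewood–Offord problem).
* The difference `T_S - T_Z` telescopes into `∑ n_i` products, each with a factor
  `(t_i - 1) ^ (s + 1) M_i`. Of the remaining copies of `a_i` and `b_i`, the more numerous kind is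
  split into `s + 1` blocks: `s` blocks absorb one factor `t_i - 1` each, at the cost of
  `(n_i u_i)^(-1/2)`, and the last block, together with all other groups, absorbs the last factor in
  the uniform norm, at the cost of `(w_i / min w) (∑ n_l u_l)^(-1/2)` (`norm_smoothing_le`).
-/

/-! ### Binomial estimates -/

lemma centralBinom_sq_le (n : ℕ) : (2 * n + 1) * n.centralBinom ^ 2 ≤ 16 ^ n := by
  induction n with
  | zero => simp
  | succ n ih =>
    have h := Nat.succ_mul_centralBinom_succ n
    have h2 : (n + 1) ^ 2 * ((2 * (n + 1) + 1) * (n + 1).centralBinom ^ 2) ≤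
        (n + 1) ^ 2 * 16 ^ (n + 1) := by
      calc (n + 1) ^ 2 * ((2 * (n + 1) + 1) * (n + 1).centralBinom ^ 2)
          = (2 * n + 3) * ((n + 1) * (n + 1).centralBinom) ^ 2 := by ring
        _ = (4 * (2 * n + 3) * (2 * n + 1)) * ((2 * n + 1) * n.centralBinom ^ 2) := by
            rw [h]; ring
        _ ≤ (16 * (n + 1) ^ 2) * 16 ^ n := Nat.mul_le_mul (by nlinarith) ih
        _ = (n + 1) ^ 2 * 16 ^ (n + 1) := by ring
    exact Nat.le_of_mul_le_mul_left h2 (by positivity)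

lemma choose_half_sq_le (r : ℕ) : (r + 1) * r.choose (r / 2) ^ 2 ≤ 4 ^ r := by
  rcases Nat.even_or_odd' r with ⟨n, rfl | rfl⟩
  · rw [Nat.mul_div_cancel_left n two_pos, pow_mul]
    exact centralBinom_sq_le n
  · have hd : (2 * n + 1) / 2 = n := by omega
    have hc : (n + 1).centralBinom = 2 * (2 * n + 1).choose n := by
      rw [Nat.centralBinom_eq_two_mul_choose, mul_add, mul_one, Nat.choose_succ_succ',
        Nat.choose_symm_half]
      ring
    have h := centralBinom_sq_le (n + 1)
    rw [hc] at h
    rw [hd, pow_succ 4, pow_mul 4]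
    norm_num [pow_succ 16, mul_pow] at h ⊢
    nlinarith [h, Nat.zero_le ((2 * n + 1).choose n ^ 2)]

lemma choose_half_le (r : ℕ) : (r.choose (r / 2) : ℝ) ≤ 2 ^ r / √(r + 1) := by
  have h : ((r : ℝ) + 1) * (r.choose (r / 2) : ℝ) ^ 2 ≤ 4 ^ r := by
    exact_mod_cast choose_half_sq_le r
  rw [le_div_iff₀ (by positivity)]
  refine le_of_sq_le_sq ?_ (by positivity)
  rw [mul_pow, Real.sq_sqrt (by positivity), ← pow_mul, mul_comm r 2, pow_mul]
  norm_num
  linarith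

lemma sum_mul_choose_mul_pow {R : Type*} [CommRing R] (n : ℕ) (t : R) :
    ∑ k ∈ Finset.range (n + 2), (k : R) * ((n + 1).choose k : R) * t ^ k =
      (n + 1) * t * (1 + t) ^ n := by
  rw [Finset.sum_range_succ', add_comm (1 : R), add_pow, Finset.mul_sum]
  simp only [Nat.cast_zero, zero_mul, add_zero, one_pow, mul_one]
  refine Finset.sum_congr rfl fun k _ => ?_
  have h : ((n : R) + 1) * (n.choose k : R) = ((n + 1).choose (k + 1) : R) * ((k : R) + 1) := by
    exact_mod_cast congrArg (Nat.cast (R := R)) (Nat.add_one_mul_choose_eq n k)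
  push_cast
  calc ((k : R) + 1) * ((n + 1).choose (k + 1) : R) * t ^ (k + 1)
      = (((n + 1).choose (k + 1) : R) * ((k : R) + 1)) * t ^ (k + 1) := by ring
    _ = _ := by rw [← h]; ring

/-- Coefficients of `(t - 1) (1 + t) ^ n`, up to the factor `n + 1`. -/
lemma succ_mul_sub_one_mul_pow {R : Type*} [CommRing R] (n : ℕ) (t : R) :
    (n + 1) * ((t - 1) * (1 + t) ^ n) =
      ∑ k ∈ Finset.range (n + 2), (2 * (k : R) - (n + 1)) * ((n + 1).choose k : R) * t ^ k := by
  have h1 := sum_mul_choose_mul_pow n t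
  have h2 : (1 + t) ^ (n + 1) = ∑ k ∈ Finset.range (n + 2), ((n + 1).choose k : R) * t ^ k := by
    rw [add_comm (1 : R), add_pow]
    exact Finset.sum_congr rfl fun k _ => by rw [one_pow]; ring
  calc (n + 1) * ((t - 1) * (1 + t) ^ n)
      = 2 * ((n + 1) * t * (1 + t) ^ n) - (n + 1) * (1 + t) ^ (n + 1) := by ring
    _ = _ := by
      rw [← h1, h2, Finset.mul_sum, Finset.mul_sum, ← Finset.sum_sub_distrib]
      exact Finset.sum_congr rfl fun k _ => by ring

lemma sum_sq_mul_choose (n : ℕ) :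
    ∑ k ∈ Finset.range (n + 1), (2 * (k : ℝ) - n) ^ 2 * (n.choose k : ℝ) = (n : ℝ) * 2 ^ n := by
  have h := congrArg (Polynomial.eval (1 / 2 : ℝ)) (bernsteinPolynomial.variance ℝ n)
  simp only [bernsteinPolynomial, Polynomial.eval_finsetSum, Polynomial.eval_mul,
    Polynomial.eval_pow, Polynomial.eval_sub, nsmul_eq_mul, Polynomial.eval_natCast,
    Polynomial.eval_X, Polynomial.eval_one] at h
  calc ∑ k ∈ Finset.range (n + 1), (2 * (k : ℝ) - n) ^ 2 * (n.choose k : ℝ)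
      = 4 * 2 ^ n * ∑ k ∈ Finset.range (n + 1), ((n : ℝ) * (1 / 2) - k) ^ 2 *
          (n.choose k * (1 / 2) ^ k * (1 - 1 / 2) ^ (n - k)) := by
        rw [Finset.mul_sum]
        refine Finset.sum_congr rfl fun k hk => ?_
        have hk' : k ≤ n := Nat.lt_succ_iff.mp (Finset.mem_range.mp hk)
        have h3 : (2 : ℝ) ^ n * ((1 / 2) ^ k * (1 - 1 / 2) ^ (n - k)) = 1 := by
          have : (1 - 1 / 2 : ℝ) = 1 / 2 := by norm_num
          rw [this, ← pow_add, Nat.add_sub_cancel' hk', ← mul_pow]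
          norm_num
        linear_combination (-(2 * (k : ℝ) - n) ^ 2 * (n.choose k : ℝ)) * h3
    _ = (n : ℝ) * 2 ^ n := by rw [h]; ring

/-- The mean deviation of a symmetric binomial law, through its variance. -/
lemma sum_abs_mul_choose_le (n : ℕ) :
    ∑ k ∈ Finset.range (n + 1), |2 * (k : ℝ) - n| * (n.choose k : ℝ) ≤ √n * 2 ^ n := by
  refine le_of_sq_le_sq ?_ (by positivity)
  calc (∑ k ∈ Finset.range (n + 1), |2 * (k : ℝ) - n| * (n.choose k : ℝ)) ^ 2
      = (∑ k ∈ Finset.range (n + 1),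
          (|2 * (k : ℝ) - n| * √(n.choose k : ℝ)) * √(n.choose k : ℝ)) ^ 2 := by
        congr 1
        refine Finset.sum_congr rfl fun k _ => ?_
        rw [mul_assoc, Real.mul_self_sqrt (by positivity)]
    _ ≤ (∑ k ∈ Finset.range (n + 1), (|2 * (k : ℝ) - n| * √(n.choose k : ℝ)) ^ 2) *
          ∑ k ∈ Finset.range (n + 1), √(n.choose k : ℝ) ^ 2 :=
        Finset.sum_mul_sq_le_sq_mul_sq _ _ _
    _ = ((n : ℝ) * 2 ^ n) * 2 ^ n := by
        congr 1
        · rw [← sum_sq_mul_choose]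
          refine Finset.sum_congr rfl fun k _ => ?_
          rw [mul_pow, sq_abs, Real.sq_sqrt (by positivity)]
        · rw [Finset.sum_congr rfl fun k _ => Real.sq_sqrt (by positivity)]
          exact_mod_cast Nat.sum_range_choose n
    _ = (√n * 2 ^ n) ^ 2 := by
        rw [mul_pow, Real.sq_sqrt (by positivity)]; ring

/-! ### Random subsets -/

lemma integral_exp_neg_mul_one_sub_le (l : ℝ) (hl : 0 < l) :
    ∫ t in (0 : ℝ)..1, Real.exp (-(l * (1 - t))) ≤ 1 / l := by
  have hd : ∀ t ∈ Set.uIcc (0 : ℝ) 1,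
      HasDerivAt (fun t : ℝ => Real.exp (-(l * (1 - t))) / l) (Real.exp (-(l * (1 - t)))) t := by
    intro t _
    have h1 : HasDerivAt (fun t : ℝ => -(l * (1 - t))) l t := by
      have := ((hasDerivAt_id t).sub_const 1).const_mul l
      simp only [id, mul_one] at this
      exact this.congr_of_eventuallyEq (Filter.Eventually.of_forall fun y => by ring)
    have h2 := h1.exp.div_const l
    rwa [mul_div_assoc, div_self hl.ne', mul_one] at h2
  rw [intervalIntegral.integral_eq_sub_of_hasDerivAt hd
    ((by fun_prop : Continuous fun t : ℝ => Real.exp (-(l * (1 - t)))).intervalIntegrable _ _)]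
  have : 0 < Real.exp (-(l * (1 - 0))) / l := by positivity
  simp only [sub_self, mul_zero, neg_zero, Real.exp_zero]
  linarith

/-- Let `J` be a random subset of `s` that contains each `i` independently with probability
`u i`. Then `E (1 + |J|)⁻¹ ≤ 2 / (1 + E |J|)`. The proof integrates the generating function
`E t ^ |J| = ∏ (1 - u i (1 - t)) ≤ exp (-(1 - t) E |J|)` over `[0, 1]`. -/
lemma sum_powerset_inv_card_le {ι : Type*} [DecidableEq ι] (s : Finset ι) (u : ι → ℝ)
    (h0 : ∀ i ∈ s, 0 ≤ u i) (h1 : ∀ i ∈ s, u i ≤ 1) :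
    ∑ J ∈ s.powerset, ((∏ i ∈ J, u i) * ∏ i ∈ s \ J, (1 - u i)) * (1 / ((J.card : ℝ) + 1)) ≤
      2 / (1 + ∑ i ∈ s, u i) := by
  have hp : ∀ J ∈ s.powerset, 0 ≤ (∏ i ∈ J, u i) * ∏ i ∈ s \ J, (1 - u i) := fun J hJ =>
    mul_nonneg (Finset.prod_nonneg fun i hi => h0 i (Finset.mem_powerset.mp hJ hi))
      (Finset.prod_nonneg fun i hi => sub_nonneg.mpr (h1 i (Finset.mem_sdiff.mp hi).1))
  have hl0 : 0 ≤ ∑ i ∈ s, u i := Finset.sum_nonneg h0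
  set l := ∑ i ∈ s, u i with hl
  set p : Finset ι → ℝ := fun J => (∏ i ∈ J, u i) * ∏ i ∈ s \ J, (1 - u i) with hpdef
  have hint : ∑ J ∈ s.powerset, p J * (1 / ((J.card : ℝ) + 1)) =
      ∫ t in (0 : ℝ)..1, ∏ i ∈ s, (u i * t + (1 - u i)) := by
    have he : ∀ t : ℝ, ∏ i ∈ s, (u i * t + (1 - u i)) = ∑ J ∈ s.powerset, p J * t ^ J.card := by
      intro t
      rw [Finset.prod_add]
      refine Finset.sum_congr rfl fun J _ => ?_
      rw [Finset.prod_mul_distrib, Finset.prod_const, hpdef]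
      ring
    simp_rw [he]
    rw [intervalIntegral.integral_finsetSum fun J _ =>
      (by fun_prop : Continuous fun t : ℝ => p J * t ^ J.card).intervalIntegrable _ _]
    refine Finset.sum_congr rfl fun J _ => ?_
    rw [intervalIntegral.integral_const_mul, integral_pow]
    simp
  have hle : ∫ t in (0 : ℝ)..1, ∏ i ∈ s, (u i * t + (1 - u i)) ≤
      ∫ t in (0 : ℝ)..1, Real.exp (-(l * (1 - t))) := by
    refine intervalIntegral.integral_mono_on zero_le_one ?_ ?_ fun t ht => ?_
    · exact (by fun_prop : Continuous fun t : ℝ =>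
        ∏ i ∈ s, (u i * t + (1 - u i))).intervalIntegrable _ _
    · exact (by fun_prop : Continuous fun t : ℝ =>
        Real.exp (-(l * (1 - t)))).intervalIntegrable _ _
    · have : -(l * (1 - t)) = ∑ i ∈ s, -(u i * (1 - t)) := by
        rw [hl, Finset.sum_neg_distrib, Finset.sum_mul]
      rw [this, Real.exp_sum]
      refine Finset.prod_le_prod (fun i hi => ?_) fun i _ => ?_
      · have := mul_nonneg (h0 i hi) ht.1
        have := h1 i hi
        linarith
      · have := Real.add_one_le_exp (-(u i * (1 - t)))
        linarith
  rw [hint]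
  rcases le_or_gt l 1 with hl1 | hl1
  · have h2 : ∫ t in (0 : ℝ)..1, Real.exp (-(l * (1 - t))) ≤ ∫ _ in (0 : ℝ)..1, (1 : ℝ) := by
      refine intervalIntegral.integral_mono_on zero_le_one ?_ (by simp) fun t ht => ?_
      · exact (by fun_prop : Continuous fun t : ℝ =>
          Real.exp (-(l * (1 - t)))).intervalIntegrable _ _
      · refine Real.exp_le_one_iff.mpr (neg_nonpos.mpr (mul_nonneg hl0 ?_))
        linarith [ht.2]
    have h3 : (1 : ℝ) ≤ 2 / (1 + l) := by
      rw [le_div_iff₀ (by linarith)]; linarith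
    simp at h2
    linarith
  · have h2 := integral_exp_neg_mul_one_sub_le l (by linarith)
    have h3 : 1 / l ≤ 2 / (1 + l) := by
      rw [div_le_div_iff₀ (by linarith) (by linarith)]; linarith
    linarith

lemma sum_powerset_inv_sqrt_card_le {ι : Type*} [DecidableEq ι] (s : Finset ι) (u : ι → ℝ)
    (h0 : ∀ i ∈ s, 0 ≤ u i) (h1 : ∀ i ∈ s, u i ≤ 1) :
    ∑ J ∈ s.powerset, ((∏ i ∈ J, u i) * ∏ i ∈ s \ J, (1 - u i)) * (1 / √((J.card : ℝ) + 1)) ≤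
      √(2 / (1 + ∑ i ∈ s, u i)) := by
  have hp : ∀ J ∈ s.powerset, 0 ≤ (∏ i ∈ J, u i) * ∏ i ∈ s \ J, (1 - u i) := fun J hJ =>
    mul_nonneg (Finset.prod_nonneg fun i hi => h0 i (Finset.mem_powerset.mp hJ hi))
      (Finset.prod_nonneg fun i hi => sub_nonneg.mpr (h1 i (Finset.mem_sdiff.mp hi).1))
  have hp1 : ∑ J ∈ s.powerset, (∏ i ∈ J, u i) * ∏ i ∈ s \ J, (1 - u i) = 1 := by
    rw [← Finset.prod_add]
    simp
  refine Real.le_sqrt_of_sq_le ?_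
  refine le_trans ?_ (sum_powerset_inv_card_le s u h0 h1)
  calc (∑ J ∈ s.powerset, ((∏ i ∈ J, u i) * ∏ i ∈ s \ J, (1 - u i)) *
          (1 / √((J.card : ℝ) + 1))) ^ 2
      ≤ ∑ J ∈ s.powerset, ((∏ i ∈ J, u i) * ∏ i ∈ s \ J, (1 - u i)) *
          (1 / √((J.card : ℝ) + 1)) ^ 2 :=
        Real.pow_arith_mean_le_arith_mean_pow _ _ _ hp hp1 (fun J _ => by positivity) 2
    _ = _ := by
        refine Finset.sum_congr rfl fun J _ => ?_
        rw [div_pow, one_pow, Real.sq_sqrt (by positivity)]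

/-! ### Mixtures in a commutative Banach algebra -/

section Mixture

variable {A E ι : Type*} [NormedCommRing A] [NormedAddCommGroup E] [Module A E] [IsBoundedSMul A E]

lemma norm_prod_le_prod [DecidableEq ι] (h1 : ‖(1 : A)‖ ≤ 1) (s : Finset ι) (a : ι → A) (u : ι → ℝ)
    (h : ∀ i ∈ s, ‖a i‖ ≤ u i) : ‖∏ i ∈ s, a i‖ ≤ ∏ i ∈ s, u i := by
  induction s using Finset.induction_on with
  | empty => simpa using h1
  | insert i s hi ih =>
    rw [Finset.prod_insert hi, Finset.prod_insert hi]
    refine (norm_mul_le _ _).trans ?_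
    have hu := h i (Finset.mem_insert_self i s)
    exact mul_le_mul hu (ih fun j hj => h j (Finset.mem_insert_of_mem hj)) (norm_nonneg _)
      ((norm_nonneg _).trans hu)

/-- If every `T i` is a mixture of a multiple of `B i`, of weight `u i`, and a remainder, of weight
`1 - u i`, then a smoothing bound for the products of the `B i` carries over to the `T i`, with the
number of factors replaced by the expected number `∑ u i`. -/
lemma norm_prod_smul_le_of_mixture [DecidableEq ι] (h1 : ‖(1 : A)‖ ≤ 1) (s : Finset ι)
    (T a B r : ι → A) (u : ι → ℝ) (v : E) (κ : ℝ) (hT : ∀ i ∈ s, T i = a i * B i + r i)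
    (ha : ∀ i ∈ s, ‖a i‖ ≤ u i) (hr : ∀ i ∈ s, ‖r i‖ ≤ 1 - u i)
    (hB : ∀ J ⊆ s, ‖(∏ i ∈ J, B i) • v‖ ≤ κ / √((J.card : ℝ) + 1)) :
    ‖(∏ i ∈ s, T i) • v‖ ≤ κ * √(2 / (1 + ∑ i ∈ s, u i)) := by
  have h0 : ∀ i ∈ s, 0 ≤ u i := fun i hi => (norm_nonneg _).trans (ha i hi)
  have h1' : ∀ i ∈ s, u i ≤ 1 := fun i hi => sub_nonneg.mp ((norm_nonneg _).trans (hr i hi))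
  have hκ : 0 ≤ κ := by
    have := (norm_nonneg _).trans (hB ∅ (Finset.empty_subset _))
    simpa using this
  rw [Finset.prod_congr rfl hT, Finset.prod_add, Finset.sum_smul]
  refine (norm_sum_le _ _).trans ?_
  refine le_trans ?_ (mul_le_mul_of_nonneg_left (sum_powerset_inv_sqrt_card_le s u h0 h1') hκ)
  rw [Finset.mul_sum]
  refine Finset.sum_le_sum fun J hJ => ?_
  have hJs := Finset.mem_powerset.mp hJ
  have hu0 : 0 ≤ ∏ i ∈ J, u i := Finset.prod_nonneg fun i hi => h0 i (hJs hi)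
  have hr0 : 0 ≤ ∏ i ∈ s \ J, (1 - u i) := Finset.prod_nonneg fun i hi =>
    sub_nonneg.mpr (h1' i (Finset.mem_sdiff.mp hi).1)
  have hsplit : ((∏ i ∈ J, a i * B i) * ∏ i ∈ s \ J, r i) • v =
      ((∏ i ∈ J, a i) * ∏ i ∈ s \ J, r i) • ((∏ i ∈ J, B i) • v) := by
    rw [smul_smul, Finset.prod_mul_distrib]
    congr 1
    ring
  rw [hsplit]
  calc ‖((∏ i ∈ J, a i) * ∏ i ∈ s \ J, r i) • ((∏ i ∈ J, B i) • v)‖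
      ≤ ‖(∏ i ∈ J, a i) * ∏ i ∈ s \ J, r i‖ * ‖(∏ i ∈ J, B i) • v‖ := norm_smul_le _ _
    _ ≤ ((∏ i ∈ J, u i) * ∏ i ∈ s \ J, (1 - u i)) * (κ / √((J.card : ℝ) + 1)) := by
        refine mul_le_mul ((norm_mul_le _ _).trans (mul_le_mul ?_ ?_ (norm_nonneg _) hu0))
          (hB J hJs) (norm_nonneg _) (mul_nonneg hu0 hr0)
        · exact norm_prod_le_prod h1 _ _ _ fun i hi => ha i (hJs hi)
        · exact norm_prod_le_prod h1 _ _ _ fun i hi => hr i (Finset.mem_sdiff.mp hi).1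
    _ = _ := by ring

end Mixture

/-! ### Laurent series in a power-bounded unit -/

section Laurent

variable {A : Type*} [NormedCommRing A] [NormedAlgebra ℝ A]

/-- The Laurent series `∑ f k t ^ k` in a unit `t` of a Banach algebra. With `t` the translation
by `w`, it is the convolution operator of the image under `k ↦ w k` of the measure on `ℤ` with
point masses `f k`. -/
noncomputable def laurent (t : Aˣ) (f : ℤ → ℝ) : A := ∑' k : ℤ, f k • ((t ^ k : Aˣ) : A)

lemma norm_one_le_of_zpow {R : Type*} [NormedCommRing R] {t : Rˣ}
    (ht : ∀ k : ℤ, ‖((t ^ k : Rˣ) : R)‖ ≤ 1) : ‖(1 : R)‖ ≤ 1 := by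
  simpa using ht 0

lemma norm_smul_zpow_le {t : Aˣ} (ht : ∀ k : ℤ, ‖((t ^ k : Aˣ) : A)‖ ≤ 1) (f : ℤ → ℝ) (k : ℤ) :
    ‖f k • ((t ^ k : Aˣ) : A)‖ ≤ |f k| := by
  rw [norm_smul, Real.norm_eq_abs]
  exact mul_le_of_le_one_right (abs_nonneg _) (ht k)

lemma summable_laurent [CompleteSpace A] {t : Aˣ} (ht : ∀ k : ℤ, ‖((t ^ k : Aˣ) : A)‖ ≤ 1)
    {f : ℤ → ℝ} (hf : Summable f) : Summable fun k : ℤ => f k • ((t ^ k : Aˣ) : A) :=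
  Summable.of_norm_bounded hf.abs (norm_smul_zpow_le ht f)

lemma laurent_sub_laurent [CompleteSpace A] {t : Aˣ} (ht : ∀ k : ℤ, ‖((t ^ k : Aˣ) : A)‖ ≤ 1)
    {f g : ℤ → ℝ} (hf : Summable f) (hg : Summable g) :
    laurent t f - laurent t g = laurent t fun k => f k - g k := by
  rw [laurent, laurent, laurent, ← (summable_laurent ht hf).tsum_sub (summable_laurent ht hg)]
  exact tsum_congr fun k => (sub_smul _ _ _).symm

lemma norm_laurent_le {t : Aˣ} (ht : ∀ k : ℤ, ‖((t ^ k : Aˣ) : A)‖ ≤ 1)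
    {f : ℤ → ℝ} (hf : Summable f) : ‖laurent t f‖ ≤ ∑' k, |f k| :=
  tsum_of_norm_bounded hf.abs.hasSum (norm_smul_zpow_le ht f)

lemma norm_laurent_le_one {t : Aˣ} (ht : ∀ k : ℤ, ‖((t ^ k : Aˣ) : A)‖ ≤ 1)
    {f : ℤ → ℝ} (h0 : ∀ k, 0 ≤ f k) (hf : HasSum f 1) : ‖laurent t f‖ ≤ 1 := by
  refine (norm_laurent_le ht hf.summable).trans_eq ?_
  rw [← hf.tsum_eq]
  exact tsum_congr fun k => abs_of_nonneg (h0 k)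

/-- The overlap `∑ min (f k) (f (k + 1))` of a mass function with its translate by one. -/
noncomputable def overlap (f : ℤ → ℝ) : ℝ := ∑' k : ℤ, min (f k) (f (k + 1))

lemma summable_overlap {f : ℤ → ℝ} (h0 : ∀ k, 0 ≤ f k) (hf : Summable f) :
    Summable fun k : ℤ => min (f k) (f (k + 1)) :=
  Summable.of_nonneg_of_le (fun k => le_min (h0 k) (h0 _)) (fun _ => min_le_left _ _) hf

/-- A law is a mixture of a convolution with the symmetric Bernoulli law `(1 + t) / 2`, of weight
its overlap, and a remainder: put the mass `min (f k) (f (k + 1))` on the pair `{k, k + 1}`. -/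
lemma exists_laurent_eq_mixture [CompleteSpace A] {t : Aˣ}
    (ht : ∀ k : ℤ, ‖((t ^ k : Aˣ) : A)‖ ≤ 1) {f : ℤ → ℝ} (h0 : ∀ k, 0 ≤ f k) (hf : HasSum f 1) :
    ∃ a r : A, laurent t f = a * ((1 / 2 : ℝ) • (1 + (t : A))) + r ∧
      ‖a‖ ≤ overlap f ∧ ‖r‖ ≤ 1 - overlap f := by
  set m : ℤ → ℝ := fun k => min (f k) (f (k + 1)) with hm
  have hms : Summable m := summable_overlap h0 hf.summable
  have hms' : Summable fun k => m (k - 1) := (Equiv.subRight (1 : ℤ)).summable_iff.mpr hms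
  have hmt : ∑' k, m (k - 1) = ∑' k, m k := (Equiv.subRight (1 : ℤ)).tsum_eq m
  have hm0 : ∀ k, 0 ≤ m k := fun k => le_min (h0 k) (h0 _)
  set q : ℤ → ℝ := fun k => f k - (1 / 2) * (m k + m (k - 1)) with hq
  have hqs : HasSum q (1 - overlap f) := by
    have := hf.sub ((hms.hasSum.add (hmt ▸ hms'.hasSum)).mul_left (1 / 2))
    have ho : overlap f = ∑' k, m k := rfl
    have he : 1 - overlap f = 1 - 1 / 2 * (∑' k, m k + ∑' k, m k) := by
      rw [ho]
      ring
    rw [he]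
    exact this
  have hq0 : ∀ k, 0 ≤ q k := by
    intro k
    have h1 : m k ≤ f k := min_le_left _ _
    have h2 : m (k - 1) ≤ f k := by
      have : m (k - 1) ≤ f (k - 1 + 1) := min_le_right _ _
      rwa [sub_add_cancel] at this
    simp only [hq]
    linarith
  refine ⟨laurent t m, laurent t q, ?_, ?_, ?_⟩
  · have hA := summable_laurent ht hms
    have hA' := summable_laurent ht hms'
    have hF := summable_laurent ht hf.summable
    have hshift : laurent t m * (t : A) = laurent t fun k => m (k - 1) := by
      rw [laurent, ← hA.tsum_mul_right, laurent,
        ← (Equiv.subRight (1 : ℤ)).tsum_eq fun k : ℤ => m k • ((t ^ k : Aˣ) : A) * (t : A)]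
      refine tsum_congr fun k => ?_
      simp only [Equiv.subRight_apply]
      rw [smul_mul_assoc, ← Units.val_mul, ← zpow_add_one, sub_add_cancel]
    have hQ : laurent t q = laurent t f -
        (1 / 2 : ℝ) • (laurent t m + laurent t fun k => m (k - 1)) := by
      have := (hF.hasSum.sub ((hA.hasSum.add hA'.hasSum).const_smul (1 / 2 : ℝ))).tsum_eq
      rw [laurent, laurent, laurent, laurent, ← this]
      refine tsum_congr fun k => ?_
      simp only [hq, sub_smul, mul_smul, add_smul]
    rw [hQ, ← hshift, mul_smul_comm, mul_add, mul_one, add_sub_cancel]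
  · refine (norm_laurent_le ht hms).trans_eq ?_
    exact tsum_congr fun k => abs_of_nonneg (hm0 k)
  · refine (norm_laurent_le ht hqs.summable).trans_eq ?_
    rw [← hqs.tsum_eq]
    exact tsum_congr fun k => abs_of_nonneg (hq0 k)

/-- The coefficients of `(t - 1) (1 + t) ^ n` are the central deviations of a binomial law. -/
lemma norm_sub_one_mul_half_pow_le {t : Aˣ} (ht : ∀ k : ℤ, ‖((t ^ k : Aˣ) : A)‖ ≤ 1) (n : ℕ) :
    ‖((t : A) - 1) * ((1 / 2 : ℝ) • (1 + (t : A))) ^ n‖ ≤ 2 / √((n : ℝ) + 1) := by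
  have h := succ_mul_sub_one_mul_pow n (t : A)
  have hrw : ((t : A) - 1) * ((1 / 2 : ℝ) • (1 + (t : A))) ^ n =
      ((1 / 2 : ℝ) ^ n * (1 / ((n : ℝ) + 1))) •
        ∑ k ∈ Finset.range (n + 2),
          ((2 * (k : ℝ) - (n + 1 : ℕ)) * ((n + 1).choose k : ℝ)) • (t : A) ^ k := by
    have hc : ∀ k : ℕ, ((2 * (k : ℝ) - (n + 1 : ℕ)) * ((n + 1).choose k : ℝ)) • (t : A) ^ k =
        (2 * (k : A) - (n + 1)) * ((n + 1).choose k : A) * (t : A) ^ k := by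
      intro k
      rw [Algebra.smul_def]
      congr 1
      have h2 : algebraMap ℝ A 2 = 2 := map_ofNat _ 2
      simp [h2]
    rw [Finset.sum_congr rfl fun k _ => hc k, ← h, smul_pow, mul_smul_comm, mul_smul]
    congr 1
    have hn : ((n : A) + 1) = algebraMap ℝ A ((n : ℝ) + 1) := by simp
    rw [hn, ← Algebra.smul_def, smul_smul, one_div, inv_mul_cancel₀ (by positivity), one_smul]
  rw [hrw, norm_smul, Real.norm_of_nonneg (by positivity)]
  have hs : ‖∑ k ∈ Finset.range (n + 2),
      ((2 * (k : ℝ) - (n + 1 : ℕ)) * ((n + 1).choose k : ℝ)) • (t : A) ^ k‖ ≤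
      √((n + 1 : ℕ) : ℝ) * 2 ^ (n + 1) := by
    refine (norm_sum_le _ _).trans (le_trans ?_ (sum_abs_mul_choose_le (n + 1)))
    refine Finset.sum_le_sum fun k _ => ?_
    rw [norm_smul, Real.norm_eq_abs, abs_mul, Nat.abs_cast]
    refine mul_le_of_le_one_right (by positivity) ?_
    have := ht k
    rwa [zpow_natCast, Units.val_pow_eq_pow_val] at this
  refine (mul_le_mul_of_nonneg_left hs (by positivity)).trans_eq ?_
  push_cast
  have hsq : √((n : ℝ) + 1) * √((n : ℝ) + 1) = n + 1 := Real.mul_self_sqrt (by positivity)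
  have h2 : (1 / 2 : ℝ) ^ n * 2 ^ n = 1 := by rw [← mul_pow]; norm_num
  rw [eq_div_iff (by positivity), pow_succ]
  have h3 : (1 / ((n : ℝ) + 1)) * (n + 1) = 1 := by field_simp
  calc _ = ((1 / 2 : ℝ) ^ n * 2 ^ n) * ((1 / ((n : ℝ) + 1)) *
        (√((n : ℝ) + 1) * √((n : ℝ) + 1))) * 2 := by ring
    _ = 2 := by rw [hsq, h2, h3]; ring

/-- The smoothing inequality `‖(I₁ - I) Fⁿ‖ = O((1 + n u)^(-1/2))` in total variation. -/
lemma norm_sub_one_mul_laurent_pow_le [CompleteSpace A] {t : Aˣ}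
    (ht : ∀ k : ℤ, ‖((t ^ k : Aˣ) : A)‖ ≤ 1) {f : ℤ → ℝ} (h0 : ∀ k, 0 ≤ f k) (hf : HasSum f 1)
    (n : ℕ) :
    ‖((t : A) - 1) * laurent t f ^ n‖ ≤ 2 * √(2 / (1 + n * overlap f)) := by
  obtain ⟨a, r, hT, ha, hr⟩ := exists_laurent_eq_mixture ht h0 hf
  have h := norm_prod_smul_le_of_mixture (E := A) (norm_one_le_of_zpow ht) (Finset.range n)
    (fun _ => laurent t f) (fun _ => a) (fun _ => (1 / 2 : ℝ) • (1 + (t : A))) (fun _ => r)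
    (fun _ => overlap f) ((t : A) - 1) 2 (fun _ _ => hT) (fun _ _ => ha) (fun _ _ => hr)
    (fun J _ => by
      rw [Finset.prod_const, smul_eq_mul, mul_comm]
      exact norm_sub_one_mul_half_pow_le ht J.card)
  simpa [mul_comm] using h

/-! ### Factorial moment expansion -/

/-- Taylor expansion of `t ^ m` at `1` with a remainder of norm at most `m.choose (s + 1)`. -/
lemma exists_pow_eq_taylor {t : A} (h1 : ‖(1 : A)‖ ≤ 1) (ht : ‖t‖ ≤ 1) (s m : ℕ) :
    ∃ R : A, t ^ m = ∑ k ∈ Finset.range (s + 1), (m.choose k : ℝ) • (t - 1) ^ k +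
      (t - 1) ^ (s + 1) * R ∧ ‖R‖ ≤ m.choose (s + 1) := by
  induction m with
  | zero =>
    refine ⟨0, ?_, by simp⟩
    rw [Finset.sum_range_succ']
    simp
  | succ m ih =>
    obtain ⟨R, hR, hRn⟩ := ih
    refine ⟨t * R + (m.choose s : ℝ) • 1, ?_, ?_⟩
    · have hsum : ∑ k ∈ Finset.range (s + 1), ((m + 1).choose k : ℝ) • (t - 1) ^ k =
          t * ∑ k ∈ Finset.range (s + 1), (m.choose k : ℝ) • (t - 1) ^ k -
            (m.choose s : ℝ) • (t - 1) ^ (s + 1) := by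
        clear hR hRn
        induction s with
        | zero => simp
        | succ s ih =>
          rw [Finset.sum_range_succ, ih, Finset.sum_range_succ _ (s + 1), Nat.choose_succ_succ']
          simp only [Algebra.smul_def, Nat.cast_add, map_add, map_natCast]
          ring
      rw [hsum, pow_succ, hR]
      simp only [Algebra.smul_def]
      ring
    · rw [Nat.choose_succ_succ', Nat.cast_add, add_comm (m.choose s : ℝ)]
      refine (norm_add_le _ _).trans (add_le_add ?_ ?_)
      · calc ‖t * R‖ ≤ ‖t‖ * ‖R‖ := norm_mul_le _ _
          _ ≤ 1 * ‖R‖ := by gcongr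
          _ ≤ _ := by rwa [one_mul]
      · rw [norm_smul, Real.norm_natCast]
        exact mul_le_of_le_one_right (by positivity) h1

lemma descFactorial_mono_right {m k l : ℕ} (hkl : k ≤ l) (hl : l ≤ m) :
    m.descFactorial k ≤ m.descFactorial l := by
  induction l, hkl using Nat.le_induction with
  | base => exact le_rfl
  | succ l _ ih =>
    rw [Nat.descFactorial_succ]
    exact (ih (by omega)).trans (Nat.le_mul_of_pos_left _ (by omega))

lemma summable_mul_choose_of_le {h : ℕ → ℝ} {s k : ℕ} (hk : k ≤ s)
    (hs : Summable fun m : ℕ => |h m| * (m.descFactorial s : ℝ)) :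
    Summable fun m : ℕ => h m * (m.choose k : ℝ) := by
  refine Summable.of_norm_bounded_eventually_nat hs ?_
  filter_upwards [Filter.eventually_ge_atTop s] with m hm
  rw [norm_mul, Real.norm_eq_abs, Real.norm_natCast]
  refine mul_le_mul_of_nonneg_left ?_ (abs_nonneg _)
  have h1 : m.choose k ≤ m.descFactorial k := by
    rw [Nat.descFactorial_eq_factorial_mul_choose]
    exact Nat.le_mul_of_pos_left _ (Nat.factorial_pos k)
  exact_mod_cast h1.trans (descFactorial_mono_right hk hm)

/-- One side of the expansion: when the factorial moments of orders `1, …, s` of a signed mass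
function on `ℕ` vanish, `∑ h m (t ^ m - 1)` is divisible by `(t - 1) ^ (s + 1)`. -/
lemma exists_tsum_smul_pow_sub_one [CompleteSpace A] {t : A} (h1 : ‖(1 : A)‖ ≤ 1) (ht : ‖t‖ ≤ 1)
    {h : ℕ → ℝ} {s : ℕ} (hs : Summable fun m : ℕ => |h m| * (m.descFactorial (s + 1) : ℝ))
    (hmom : ∀ k ∈ Finset.Icc 1 s, ∑' m : ℕ, h m * (m.descFactorial k : ℝ) = 0) :
    ∃ M : A, HasSum (fun m : ℕ => h m • (t ^ m - 1)) ((t - 1) ^ (s + 1) * M) ∧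
      ‖M‖ ≤ ∑' m : ℕ, |h m| * (m.descFactorial (s + 1) : ℝ) := by
  choose R hR hRn using exists_pow_eq_taylor h1 ht s
  have hb : ∀ m, ‖h m • R m‖ ≤ |h m| * (m.descFactorial (s + 1) : ℝ) := by
    intro m
    rw [norm_smul, Real.norm_eq_abs]
    refine mul_le_mul_of_nonneg_left ((hRn m).trans ?_) (abs_nonneg _)
    rw [Nat.descFactorial_eq_factorial_mul_choose]
    exact_mod_cast Nat.le_mul_of_pos_left _ (Nat.factorial_pos _)
  have hsum : Summable fun m => h m • R m := Summable.of_norm_bounded hs hb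
  refine ⟨∑' m, h m • R m, ?_, tsum_of_norm_bounded hs.hasSum hb⟩
  have hterm : ∀ k ∈ Finset.range s,
      HasSum (fun m : ℕ => (h m * (m.choose (k + 1) : ℝ)) • (t - 1) ^ (k + 1)) 0 := by
    intro k hk
    have hk' : k + 1 ≤ s := Finset.mem_range.mp hk
    have h2 := (summable_mul_choose_of_le (hk'.trans s.le_succ) hs).hasSum
    have h3 : ∑' m : ℕ, h m * (m.choose (k + 1) : ℝ) = 0 := by
      have h4 := hmom (k + 1) (Finset.mem_Icc.mpr ⟨by omega, hk'⟩)
      have h5 : ∀ m : ℕ, h m * (m.descFactorial (k + 1) : ℝ) =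
          ((k + 1).factorial : ℝ) * (h m * (m.choose (k + 1) : ℝ)) := by
        intro m
        rw [Nat.descFactorial_eq_factorial_mul_choose]
        push_cast
        ring
      rw [tsum_congr h5, tsum_mul_left] at h4
      exact (mul_eq_zero.mp h4).resolve_left (by positivity)
    rw [h3] at h2
    simpa using h2.smul_const ((t - 1) ^ (k + 1))
  have h6 := (hasSum_sum hterm).add (hsum.hasSum.mul_left ((t - 1) ^ (s + 1)))
  rw [Finset.sum_const_zero, zero_add] at h6
  refine h6.congr_fun fun m => ?_
  rw [hR m, Finset.sum_range_succ']
  simp only [Nat.choose_zero_right, Nat.cast_one, pow_zero, one_smul, mul_smul]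
  rw [← Finset.smul_sum, mul_smul_comm, ← smul_add]
  congr 1
  abel

/-- Two laws on `ℤ` with the same one-sided factorial moments of orders `1, …, s` differ by a
multiple of `(t - 1) ^ (s + 1)`; here `h` is the difference of their mass functions. The masses of the
two half-lines need not agree: the zeroth order terms of both sides cancel because `h` has total mass
zero. -/
lemma exists_laurent_sub_laurent [CompleteSpace A] {t : Aˣ}
    (ht : ∀ k : ℤ, ‖((t ^ k : Aˣ) : A)‖ ≤ 1) {h : ℤ → ℝ} (hh : HasSum h 0) {s : ℕ}
    (hp : Summable fun m : ℕ => |h m| * (m.descFactorial (s + 1) : ℝ))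
    (hn : Summable fun m : ℕ => |h (-m)| * (m.descFactorial (s + 1) : ℝ))
    (hpm : ∀ k ∈ Finset.Icc 1 s, ∑' m : ℕ, h m * (m.descFactorial k : ℝ) = 0)
    (hnm : ∀ k ∈ Finset.Icc 1 s, ∑' m : ℕ, h (-m) * (m.descFactorial k : ℝ) = 0) :
    ∃ M : A, laurent t h = ((t : A) - 1) ^ (s + 1) * M ∧
      ‖M‖ ≤ ∑' m : ℕ, |h m| * (m.descFactorial (s + 1) : ℝ) +
        ∑' m : ℕ, |h (-m)| * (m.descFactorial (s + 1) : ℝ) := by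
  have h1 := norm_one_le_of_zpow ht
  have ht1 : ‖(t : A)‖ ≤ 1 := by simpa using ht 1
  have ht2 : ‖((t⁻¹ : Aˣ) : A)‖ ≤ 1 := by simpa using ht (-1)
  obtain ⟨M, hM, hMn⟩ := exists_tsum_smul_pow_sub_one h1 ht1 hp hpm
  obtain ⟨M', hM', hMn'⟩ := exists_tsum_smul_pow_sub_one (h := fun m => h (-m)) h1 ht2 hn hnm
  set c : A := (-((t⁻¹ : Aˣ) : A)) ^ (s + 1) with hc
  have hcn : ‖c‖ ≤ 1 := by
    refine (norm_pow_le' _ s.succ_pos).trans ?_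
    rw [norm_neg]
    exact pow_le_one₀ (norm_nonneg _) ht2
  refine ⟨M + c * M', ?_, ?_⟩
  · have hφ : HasSum (fun k : ℤ => h k • (((t ^ k : Aˣ) : A) - 1))
        (((t : A) - 1) ^ (s + 1) * M + (((t⁻¹ : Aˣ) : A) - 1) ^ (s + 1) * M' -
          h 0 • (((t ^ (0 : ℤ) : Aˣ) : A) - 1)) := by
      refine HasSum.of_nat_of_neg ?_ ?_
      · exact hM.congr_fun fun m => by rw [zpow_natCast, Units.val_pow_eq_pow_val]
      · exact hM'.congr_fun fun m => by
          rw [zpow_neg, zpow_natCast, ← inv_pow, Units.val_pow_eq_pow_val]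
    have hφ' := hφ.add (hh.smul_const (1 : A))
    have heq : ((t⁻¹ : Aˣ) : A) - 1 = -((t⁻¹ : Aˣ) : A) * ((t : A) - 1) := by
      rw [mul_sub, neg_mul, Units.inv_mul]
      ring
    rw [zpow_zero, Units.val_one, sub_self, smul_zero, zero_smul, sub_zero, add_zero, heq,
      mul_pow, ← hc] at hφ'
    have hfin : laurent t h = ((t : A) - 1) ^ (s + 1) * M + c * ((t : A) - 1) ^ (s + 1) * M' := by
      rw [laurent, ← hφ'.tsum_eq]
      refine tsum_congr fun k => ?_
      rw [smul_sub, sub_add_cancel]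
    rw [hfin]
    ring
  · refine (norm_add_le _ _).trans (add_le_add hMn ?_)
    calc ‖c * M'‖ ≤ ‖c‖ * ‖M'‖ := norm_mul_le _ _
      _ ≤ 1 * ‖M'‖ := by gcongr
      _ ≤ _ := by rwa [one_mul]

end Laurent

/-! ### The algebra of translations -/

/-- Bounded functions on the line with the supremum norm. -/
abbrev BddFun : Type := lp (fun _ : ℝ => ℝ) ∞

/-- Translation `v ↦ v (· + a)` of bounded functions. -/
noncomputable def shift (a : ℝ) : BddFun →L[ℝ] BddFun :=
  LinearMap.mkContinuous
    { toFun := fun v => ⟨fun x => v (x + a), memℓp_infty ⟨‖v‖, by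
        rintro _ ⟨x, rfl⟩
        exact lp.norm_apply_le_norm ENNReal.top_ne_zero v (x + a)⟩⟩
      map_add' := fun _ _ => rfl
      map_smul' := fun _ _ => rfl } 1 fun v => by
    rw [one_mul]
    exact lp.norm_le_of_forall_le (norm_nonneg v) fun x =>
      lp.norm_apply_le_norm ENNReal.top_ne_zero v (x + a)

lemma shift_apply (a : ℝ) (v : BddFun) (x : ℝ) : shift a v x = v (x + a) := rfl

lemma norm_shift_le (a : ℝ) : ‖shift a‖ ≤ 1 :=
  LinearMap.mkContinuous_norm_le _ zero_le_one _

lemma shift_zero : shift 0 = 1 := by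
  ext v x
  simp [shift_apply]

lemma shift_add (a b : ℝ) : shift (a + b) = shift a * shift b := by
  ext v x
  simp [shift_apply, add_assoc]

/-- The double commutant of the translations: a closed commutative algebra of operators on bounded
functions that contains the convolution operators of all discrete measures. -/
noncomputable def shiftAlgebra : Subalgebra ℝ (BddFun →L[ℝ] BddFun) :=
  Subalgebra.centralizer ℝ (Subalgebra.centralizer ℝ (Set.range shift))

lemma shift_mem (a : ℝ) : shift a ∈ shiftAlgebra :=
  Set.subset_centralizer_centralizer ⟨a, rfl⟩

/-- `shiftAlgebra` as a type. It is a definition rather than a coercion, so that its structure of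
commutative Banach algebra is found without unfolding the double commutant. -/
def ShiftAlg : Type := shiftAlgebra

namespace ShiftAlg

noncomputable instance : NormedCommRing ShiftAlg :=
  { (inferInstance : NormedRing shiftAlgebra) with
    mul_comm := fun x y => Subtype.ext <|
      Set.centralizer_centralizer_comm_of_comm
        (by
          rintro _ ⟨a, rfl⟩ _ ⟨b, rfl⟩
          rw [← shift_add, ← shift_add, add_comm])
        _ x.2 _ y.2 }

noncomputable instance : NormedAlgebra ℝ ShiftAlg :=
  { (inferInstance : Algebra ℝ shiftAlgebra) with
    norm_smul_le := fun r x => norm_smul_le r x.1 }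

instance : CompleteSpace ShiftAlg :=
  (Set.isClosed_centralizer _ :
    IsClosed (shiftAlgebra : Set (BddFun →L[ℝ] BddFun))).completeSpace_coe

noncomputable instance : Module ShiftAlg BddFun :=
  (inferInstance : Module shiftAlgebra BddFun)

instance : IsBoundedSMul ShiftAlg BddFun :=
  IsBoundedSMul.of_norm_smul_le fun a v => a.1.le_opNorm v

end ShiftAlg

/-- Translations as units of `ShiftAlg`. -/
noncomputable def shiftHom : Multiplicative ℝ →* ShiftAlgˣ :=
  MonoidHom.toHomUnits
    { toFun := fun a => ⟨shift a.toAdd, shift_mem _⟩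
      map_one' := Subtype.ext shift_zero
      map_mul' := fun _ _ => Subtype.ext (shift_add _ _) }

/-- The translation by `w`, as a unit of `ShiftAlg`. -/
noncomputable def shiftUnit (w : ℝ) : ShiftAlgˣ := shiftHom (Multiplicative.ofAdd w)

lemma shiftUnit_smul_apply (w : ℝ) (v : BddFun) (x : ℝ) :
    ((shiftUnit w : ShiftAlg) • v) x = v (x + w) := rfl

lemma norm_shiftUnit_le (w : ℝ) : ‖(shiftUnit w : ShiftAlg)‖ ≤ 1 := norm_shift_le w

lemma shiftUnit_zpow (w : ℝ) (k : ℤ) : shiftUnit w ^ k = shiftUnit (k * w) := by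
  rw [shiftUnit, ← map_zpow, ← ofAdd_zsmul, zsmul_eq_mul, shiftUnit]

lemma norm_shiftUnit_zpow_le (w : ℝ) (k : ℤ) :
    ‖((shiftUnit w ^ k : ShiftAlgˣ) : ShiftAlg)‖ ≤ 1 := by
  rw [shiftUnit_zpow]
  exact norm_shiftUnit_le _

lemma prod_shiftUnit {ι : Type*} (K : Finset ι) (a : ι → ℝ) :
    ∏ i ∈ K, (shiftUnit (a i) : ShiftAlg) = shiftUnit (∑ i ∈ K, a i) := by
  simp_rw [← Units.coe_prod, shiftUnit]
  rw [← map_prod, ofAdd_sum]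

/-- The continuous functional `a ↦ (a v) x` on the algebra of translations. -/
noncomputable def evalAt (v : BddFun) (x : ℝ) : ShiftAlg →L[ℝ] ℝ :=
  LinearMap.mkContinuous
    { toFun := fun a => (a • v) x
      map_add' := fun a b => by rw [add_smul]; rfl
      map_smul' := fun _ _ => rfl } ‖v‖ fun a => by
    rw [mul_comm]
    exact (lp.norm_apply_le_norm ENNReal.top_ne_zero (a • v) x).trans (norm_smul_le a v)

lemma evalAt_apply (v : BddFun) (x : ℝ) (a : ShiftAlg) : evalAt v x a = (a • v) x := rfl

lemma laurent_smul_apply (w : ℝ) {f : ℤ → ℝ} (hf : Summable f) (v : BddFun) (x : ℝ) :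
    (laurent (shiftUnit w) f • v) x = ∑' k : ℤ, f k * v (x + k * w) := by
  have h := (summable_laurent (norm_shiftUnit_zpow_le w) hf).hasSum.mapL (evalAt v x)
  rw [← evalAt_apply, laurent, ← h.tsum_eq]
  refine tsum_congr fun k => ?_
  rw [map_smul, evalAt_apply, shiftUnit_zpow, shiftUnit_smul_apply, smul_eq_mul]

/-- The indicator function of `(-∞, 0]`. -/
noncomputable def stepFun : BddFun :=
  ⟨Set.indicator (Set.Iic 0) 1, memℓp_infty ⟨1, by
    rintro _ ⟨x, rfl⟩
    by_cases hx : x ∈ Set.Iic (0 : ℝ) <;> simp [hx]⟩⟩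

lemma stepFun_apply (x : ℝ) : stepFun x = Set.indicator (Set.Iic (0 : ℝ)) 1 x := rfl

/-! ### Littlewood–Offord estimate -/

section LittlewoodOfford

variable {ι : Type*} [Fintype ι]

/-- The Littlewood–Offord–Erdős bound: subsets whose sums lie in a half-open interval of length `ω`
form an antichain. -/
lemma card_subset_sums_le (a : ι → ℝ) {ω : ℝ} (ha : ∀ i, ω ≤ a i) (hω : 0 < ω) (c : ℝ) :
    (Finset.univ.filter fun K : Finset ι => c - ω < ∑ i ∈ K, a i ∧ ∑ i ∈ K, a i ≤ c).card ≤
      (Fintype.card ι).choose (Fintype.card ι / 2) := by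
  classical
  refine IsAntichain.sperner ?_
  intro K hK L hL hne hsub
  simp only [Finset.coe_filter, Finset.mem_univ, true_and, Set.mem_ofPred_eq] at hK hL
  obtain ⟨i, hiL, hiK⟩ := Finset.exists_of_ssubset (hsub.ssubset_of_ne hne)
  have h1 : ∑ j ∈ insert i K, a j ≤ ∑ j ∈ L, a j :=
    Finset.sum_le_sum_of_subset_of_nonneg (Finset.insert_subset hiL hsub)
      fun j _ _ => hω.le.trans (ha j)
  rw [Finset.sum_insert hiK] at h1
  linarith [ha i]

/-- An interval of length `w ≥ ω` is covered by `⌈w / ω⌉ ≤ 2 w / ω` intervals of length `ω`. -/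
lemma card_subset_sums_le_mul (a : ι → ℝ) {ω w : ℝ} (ha : ∀ i, ω ≤ a i) (hω : 0 < ω)
    (hw : ω ≤ w) (c : ℝ) :
    ((Finset.univ.filter fun K : Finset ι =>
      c - w < ∑ i ∈ K, a i ∧ ∑ i ∈ K, a i ≤ c).card : ℝ) ≤
      2 * w / ω * (Fintype.card ι).choose (Fintype.card ι / 2) := by
  classical
  set L := ⌈w / ω⌉₊ with hL
  have hsub : (Finset.univ.filter fun K : Finset ι =>
      c - w < ∑ i ∈ K, a i ∧ ∑ i ∈ K, a i ≤ c) ⊆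
      (Finset.range L).biUnion fun l => Finset.univ.filter fun K : Finset ι =>
        (c - l * ω) - ω < ∑ i ∈ K, a i ∧ ∑ i ∈ K, a i ≤ c - l * ω := by
    intro K hK
    simp only [Finset.mem_filter, Finset.mem_univ, true_and, Finset.mem_biUnion,
      Finset.mem_range] at hK ⊢
    have h0 : 0 ≤ (c - ∑ i ∈ K, a i) / ω := div_nonneg (by linarith) hω.le
    refine ⟨⌊(c - ∑ i ∈ K, a i) / ω⌋₊, ?_, ?_, ?_⟩
    · rw [hL, Nat.lt_ceil]
      refine (Nat.floor_le h0).trans_lt ?_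
      exact div_lt_div_of_pos_right (by linarith) hω
    · have := Nat.lt_floor_add_one ((c - ∑ i ∈ K, a i) / ω)
      rw [div_lt_iff₀ hω] at this
      linarith
    · have := Nat.floor_le h0
      rw [le_div_iff₀ hω] at this
      linarith
  have hcard := (Finset.card_le_card hsub).trans (Finset.card_biUnion_le_card_mul _ _ _
    fun l _ => card_subset_sums_le a ha hω (c - l * ω))
  rw [Finset.card_range] at hcard
  have hL2 : (L : ℝ) ≤ 2 * w / ω := by
    have h1 : 1 ≤ w / ω := (one_le_div hω).mpr hw
    have h2 := Nat.ceil_lt_add_one (zero_le_one.trans h1)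
    rw [mul_div_assoc]
    linarith
  calc _ ≤ ((L * (Fintype.card ι).choose (Fintype.card ι / 2) : ℕ) : ℝ) := by exact_mod_cast hcard
    _ ≤ _ := by
      push_cast
      gcongr

/-- Concentration of a sum of independent symmetric Bernoulli variables with weights `a i ≥ ω`. -/
lemma norm_prod_half_smul_step_le (a : ι → ℝ) {ω w : ℝ} (ha : ∀ i, ω ≤ a i)
    (hω : 0 < ω) (hw : ω ≤ w) :
    ‖(∏ i, (1 / 2 : ℝ) • (1 + (shiftUnit (a i) : ShiftAlg))) •
        (((shiftUnit w : ShiftAlg) - 1) • stepFun)‖ ≤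
      2 * w / ω / √((Fintype.card ι : ℝ) + 1) := by
  classical
  have hw0 : 0 < w := hω.trans_le hw
  refine lp.norm_le_of_forall_le (by positivity) fun x => ?_
  set r := Fintype.card ι with hr
  have hexp : ∏ i, (1 / 2 : ℝ) • (1 + (shiftUnit (a i) : ShiftAlg)) =
      (1 / 2 : ℝ) ^ r • ∑ K : Finset ι, (shiftUnit (∑ i ∈ K, a i) : ShiftAlg) := by
    simp_rw [← prod_shiftUnit]
    rw [← Finset.powerset_univ, ← Finset.prod_one_add, ← Finset.smul_prod]
    rfl
  have hval : ((∏ i, (1 / 2 : ℝ) • (1 + (shiftUnit (a i) : ShiftAlg))) •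
        (((shiftUnit w : ShiftAlg) - 1) • stepFun)) x =
      (1 / 2 : ℝ) ^ r * ∑ K : Finset ι,
        (stepFun (x + ∑ i ∈ K, a i + w) - stepFun (x + ∑ i ∈ K, a i)) := by
    rw [← evalAt_apply, hexp, map_smul, map_sum, smul_eq_mul]
    congr 1
  rw [hval, norm_mul, Real.norm_of_nonneg (by positivity)]
  have hterm : ∀ K : Finset ι, ‖stepFun (x + ∑ i ∈ K, a i + w) - stepFun (x + ∑ i ∈ K, a i)‖ ≤
      if -x - w < ∑ i ∈ K, a i ∧ ∑ i ∈ K, a i ≤ -x then 1 else 0 := by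
    intro K
    simp only [stepFun_apply, Set.indicator_apply, Set.mem_Iic, Pi.one_apply]
    by_cases h1 : x + ∑ i ∈ K, a i ≤ 0
    · by_cases h2 : x + ∑ i ∈ K, a i + w ≤ 0
      · rw [if_pos h1, if_pos h2, sub_self, norm_zero]
        positivity
      · rw [if_pos h1, if_neg h2, if_pos ⟨by linarith, by linarith⟩]
        simp
    · rw [if_neg h1, if_neg (by linarith), sub_self, norm_zero]
      positivity
  calc (1 / 2 : ℝ) ^ r * ‖∑ K : Finset ι,
        (stepFun (x + ∑ i ∈ K, a i + w) - stepFun (x + ∑ i ∈ K, a i))‖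
      ≤ (1 / 2 : ℝ) ^ r * ∑ K : Finset ι,
          if -x - w < ∑ i ∈ K, a i ∧ ∑ i ∈ K, a i ≤ -x then (1 : ℝ) else 0 := by
        gcongr
        exact (norm_sum_le _ _).trans (Finset.sum_le_sum fun K _ => hterm K)
    _ = (1 / 2 : ℝ) ^ r * ((Finset.univ.filter fun K : Finset ι =>
          -x - w < ∑ i ∈ K, a i ∧ ∑ i ∈ K, a i ≤ -x).card : ℝ) := by
        rw [Finset.sum_boole]
    _ ≤ (1 / 2 : ℝ) ^ r * (2 * w / ω * (2 ^ r / √((r : ℝ) + 1))) := by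
        gcongr
        refine (card_subset_sums_le_mul a ha hω hw (-x)).trans ?_
        exact mul_le_mul_of_nonneg_left (choose_half_le r) (by positivity)
    _ = ((1 / 2 : ℝ) ^ r * 2 ^ r) * (2 * w / ω / √((r : ℝ) + 1)) := by ring
    _ = 2 * w / ω / √((r : ℝ) + 1) := by
        rw [← mul_pow]
        norm_num

/-- Concentration of a sum of independent weighted integer variables with mass functions `f i` and
weights `a i ≥ ω`, in terms of the total overlap `∑ overlap (f i)`. -/
lemma norm_prod_laurent_smul_step_le (a : ι → ℝ) {ω w : ℝ} (ha : ∀ i, ω ≤ a i)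
    (hω : 0 < ω) (hw : ω ≤ w) (f : ι → ℤ → ℝ) (h0 : ∀ i k, 0 ≤ f i k)
    (hf : ∀ i, HasSum (f i) 1) :
    ‖(∏ i, laurent (shiftUnit (a i)) (f i)) • (((shiftUnit w : ShiftAlg) - 1) • stepFun)‖ ≤
      2 * w / ω * √(2 / (1 + ∑ i, overlap (f i))) := by
  classical
  choose b r hT hb hr using fun i =>
    exists_laurent_eq_mixture (norm_shiftUnit_zpow_le (a i)) (h0 i) (hf i)
  refine norm_prod_smul_le_of_mixture (norm_one_le_of_zpow (norm_shiftUnit_zpow_le 0)) _ _ b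
    (fun i => (1 / 2 : ℝ) • (1 + (shiftUnit (a i) : ShiftAlg))) r _ _ _
    (fun i _ => hT i) (fun i _ => hb i) (fun i _ => hr i) fun J _ => ?_
  have h := norm_prod_half_smul_step_le (fun i : J => a i) (fun i => ha i) hω hw
  rw [Fintype.card_coe] at h
  rwa [← Finset.prod_coe_sort]

end LittlewoodOfford

/-! ### Smoothing of the telescoped difference -/

section Telescope

variable {N : ℕ}

lemma sqrt_two_div_le {x y : ℝ} {s : ℕ} (hx : 0 < x) (h : x ≤ 2 * (s + 1) * y) :
    √(2 / y) ≤ 2 * √(s + 1) * (√x)⁻¹ := by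
  have hy : 0 < y := by
    by_contra! hy
    have : 2 * ((s : ℝ) + 1) * y ≤ 0 := mul_nonpos_of_nonneg_of_nonpos (by positivity) hy
    linarith
  refine Real.sqrt_le_iff.mpr ⟨by positivity, ?_⟩
  rw [mul_pow, mul_pow, inv_pow, Real.sq_sqrt (by positivity), Real.sq_sqrt hx.le,
    ← div_eq_mul_inv, div_le_div_iff₀ hy hx]
  linarith

/-- Smoothing by `(t - 1) ^ (s + 1)`: of the `p` copies of the law `d`, split into `s + 1` blocks,
each of the first `s` blocks absorbs one difference in total variation, and the last block, together
with all other summands, absorbs one difference in the uniform norm. The hypothesis on `p` is what the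
more frequent of two laws with `n i - 1` copies in all satisfies. -/
lemma norm_smoothing_le (s : ℕ) (n : Fin N → ℕ) (w u : Fin N → ℝ) {ω W : ℝ} (hω : 0 < ω)
    (hωw : ∀ i, ω ≤ w i) (hwW : ∀ i, w i ≤ W) (hu : ∀ i, 0 ≤ u i) (hu1 : ∀ i, u i ≤ 1)
    (c : Fin N → ℤ → ℝ) (hc0 : ∀ i k, 0 ≤ c i k) (hc : ∀ i, HasSum (c i) 1)
    (hcu : ∀ i, u i ≤ overlap (c i)) (i : Fin N) (d : ℤ → ℝ) (hd0 : ∀ k, 0 ≤ d k)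
    (hd : HasSum d 1) (hdu : u i ≤ overlap d) (p : ℕ) (hp : n i ≤ 2 * p + 1)
    (hni : 0 < n i * u i) :
    ‖(laurent (shiftUnit (w i)) d ^ p *
        ∏ l ∈ Finset.univ.erase i, laurent (shiftUnit (w l)) (c l) ^ n l) •
      (((shiftUnit (w i) : ShiftAlg) - 1) ^ (s + 1) • stepFun)‖ ≤
      (4 * √(s + 1)) ^ (s + 1) * (W / ω) * (√(∑ l, n l * u l))⁻¹ * (√(n i * u i))⁻¹ ^ s := by
  set a := laurent (shiftUnit (w i)) d with ha
  set E := ∏ l ∈ Finset.univ.erase i, laurent (shiftUnit (w l)) (c l) ^ n l with hE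
  set δ : ShiftAlg := (shiftUnit (w i) : ShiftAlg) - 1 with hδ
  set m := p / (s + 1) with hm
  have hmp : m * (s + 1) ≤ p := Nat.div_mul_le_self p (s + 1)
  have hpm : p + 1 ≤ (m + 1) * (s + 1) := by
    rw [add_one_mul]
    exact Nat.lt_div_mul_add s.succ_pos
  have hnm : (n i : ℝ) ≤ 2 * (s + 1) * (m + 1) := by
    have : n i ≤ 2 * (s + 1) * (m + 1) := by nlinarith
    exact_mod_cast this
  have hΛ : n i * u i ≤ ∑ l, n l * u l :=
    Finset.single_le_sum (f := fun l => (n l : ℝ) * u l)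
      (fun l _ => mul_nonneg (by positivity) (hu l)) (Finset.mem_univ i)
  have han : ‖a‖ ≤ 1 := norm_laurent_le_one (norm_shiftUnit_zpow_le _) hd0 hd
  have h1 : ‖(1 : ShiftAlg)‖ ≤ 1 := norm_one_le_of_zpow (norm_shiftUnit_zpow_le 0)
  have hpow : ∀ (x : ShiftAlg) (y : ℝ) (k : ℕ), ‖x‖ ≤ y → ‖x ^ k‖ ≤ y ^ k := by
    intro x y k hxy
    have := norm_prod_le_prod h1 (Finset.range k) (fun _ => x) (fun _ => y) fun _ _ => hxy
    simpa using this
  -- the blocks smoothed in total variation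
  have hblock : ‖δ * a ^ m‖ ≤ 4 * √(s + 1) * (√(n i * u i))⁻¹ := by
    refine (norm_sub_one_mul_laurent_pow_le (norm_shiftUnit_zpow_le _) hd0 hd m).trans ?_
    have : √(2 / (1 + m * overlap d)) ≤ 2 * √(s + 1) * (√(n i * u i))⁻¹ := by
      refine sqrt_two_div_le hni ?_
      have h2 : (m + 1) * u i ≤ 1 + m * overlap d := by
        have := mul_le_mul_of_nonneg_left hdu (Nat.cast_nonneg (α := ℝ) m)
        linarith [hu1 i]
      calc n i * u i ≤ 2 * (s + 1) * (m + 1) * u i := mul_le_mul_of_nonneg_right hnm (hu i)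
        _ = 2 * (s + 1) * ((m + 1) * u i) := by ring
        _ ≤ _ := mul_le_mul_of_nonneg_left h2 (by positivity)
    linarith
  -- the block that joins the other summands
  have hconc : ‖(a ^ m * E) • (δ • stepFun)‖ ≤
      4 * √(s + 1) * (W / ω) * (√(∑ l, n l * u l))⁻¹ := by
    set q : Fin N → ℕ := Function.update n i m with hq
    set b : Fin N → ℤ → ℝ := Function.update c i d with hb
    have hb0 : ∀ l k, 0 ≤ b l k := by
      intro l
      rcases eq_or_ne l i with rfl | hl
      · simpa [hb] using hd0
      · simpa [hb, hl] using hc0 l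
    have hbs : ∀ l, HasSum (b l) 1 := by
      intro l
      rcases eq_or_ne l i with rfl | hl
      · simpa [hb] using hd
      · simpa [hb, hl] using hc l
    have hbu : ∀ l, u l ≤ overlap (b l) := by
      intro l
      rcases eq_or_ne l i with rfl | hl
      · simpa [hb] using hdu
      · simpa [hb, hl] using hcu l
    have hprod : a ^ m * E =
        ∏ x : (Σ l, Fin (q l)), laurent (shiftUnit (w x.1)) (b x.1) := by
      rw [Fintype.prod_sigma, ← Finset.mul_prod_erase _ _ (Finset.mem_univ i)]
      simp only [Finset.prod_const, Finset.card_univ, Fintype.card_fin]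
      congr 1
      · simp [hq, hb, ha]
      · refine Finset.prod_congr rfl fun l hl => ?_
        simp [hq, hb, Finset.ne_of_mem_erase hl]
    rw [hprod]
    refine (norm_prod_laurent_smul_step_le (fun x : (Σ l, Fin (q l)) => w x.1)
      (fun x => hωw x.1) hω (hωw i) (fun x => b x.1) (fun x => hb0 x.1)
      (fun x => hbs x.1)).trans ?_
    have hsum : ∑ x : (Σ l, Fin (q l)), overlap (b x.1) = ∑ l, (q l : ℝ) * overlap (b l) := by
      rw [Fintype.sum_sigma]
      simp
    have hq2 : √(2 / (1 + ∑ l, (q l : ℝ) * overlap (b l))) ≤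
        2 * √(s + 1) * (√(∑ l, n l * u l))⁻¹ := by
      refine sqrt_two_div_le (hni.trans_le hΛ) ?_
      have h3 : ∑ l, (q l : ℝ) * u l ≤ ∑ l, (q l : ℝ) * overlap (b l) :=
        Finset.sum_le_sum fun l _ => mul_le_mul_of_nonneg_left (hbu l) (by positivity)
      have h4 : ∑ l, (q l : ℝ) * u l = m * u i + ∑ l ∈ Finset.univ.erase i, (n l : ℝ) * u l := by
        rw [← Finset.add_sum_erase _ _ (Finset.mem_univ i)]
        congr 1
        · simp [hq]
        · refine Finset.sum_congr rfl fun l hl => ?_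
          simp [hq, Finset.ne_of_mem_erase hl]
      have h5 : 0 ≤ ∑ l ∈ Finset.univ.erase i, (n l : ℝ) * u l :=
        Finset.sum_nonneg fun l _ => mul_nonneg (by positivity) (hu l)
      rw [← Finset.add_sum_erase _ _ (Finset.mem_univ i)]
      have h6 : (n i : ℝ) * u i ≤ 2 * (s + 1) * ((m + 1) * u i) :=
        (mul_le_mul_of_nonneg_right hnm (hu i)).trans_eq (by ring)
      have h7 : (1 : ℝ) ≤ 2 * (s + 1) := by
        have : (0 : ℝ) ≤ s := Nat.cast_nonneg s
        linarith
      calc (n i : ℝ) * u i + ∑ l ∈ Finset.univ.erase i, (n l : ℝ) * u l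
          ≤ 2 * (s + 1) * ((m + 1) * u i) +
              2 * (s + 1) * ∑ l ∈ Finset.univ.erase i, (n l : ℝ) * u l :=
            add_le_add h6 (le_mul_of_one_le_left h5 h7)
        _ = 2 * (s + 1) * (u i + (m * u i + ∑ l ∈ Finset.univ.erase i, (n l : ℝ) * u l)) := by
            ring
        _ ≤ _ := by
            refine mul_le_mul_of_nonneg_left ?_ (by positivity)
            rw [← h4]
            exact add_le_add (hu1 i) h3
    rw [hsum]
    have hwi : 0 < w i := hω.trans_le (hωw i)
    calc 2 * w i / ω * √(2 / (1 + ∑ l, (q l : ℝ) * overlap (b l)))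
        ≤ 2 * W / ω * (2 * √(s + 1) * (√(∑ l, n l * u l))⁻¹) := by
          have hwi' : w i ≤ W := hwW i
          have hW : 0 < W := hwi.trans_le hwi'
          gcongr
      _ = _ := by ring
  have hfac : (a ^ p * E) • (δ ^ (s + 1) • stepFun) =
      (a ^ (p - m * (s + 1)) * (δ * a ^ m) ^ s) • ((a ^ m * E) • (δ • stepFun)) := by
    simp only [smul_smul]
    congr 1
    have : a ^ p = a ^ (p - m * (s + 1)) * ((a ^ m) ^ s * a ^ m) := by
      rw [← pow_succ, ← pow_mul, ← pow_add, Nat.sub_add_cancel hmp]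
    rw [this]
    ring_nf
  have hW : 0 ≤ W / ω := div_nonneg (hω.le.trans ((hωw i).trans (hwW i))) hω.le
  rw [hfac]
  calc ‖(a ^ (p - m * (s + 1)) * (δ * a ^ m) ^ s) • ((a ^ m * E) • (δ • stepFun))‖
      ≤ (1 ^ (p - m * (s + 1)) * (4 * √(s + 1) * (√(n i * u i))⁻¹) ^ s) *
          (4 * √(s + 1) * (W / ω) * (√(∑ l, n l * u l))⁻¹) := by
        refine (norm_smul_le _ _).trans (mul_le_mul ((norm_mul_le _ _).trans ?_) hconc
          (norm_nonneg _) (by positivity))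
        exact mul_le_mul (hpow _ _ _ han) (hpow _ _ _ hblock) (norm_nonneg _) (by positivity)
    _ = _ := by
        rw [one_pow, one_mul, mul_pow, pow_succ]
        ring

lemma pow_sub_pow_mul_eq_sum {R : Type*} [CommRing R] (a b E : R) (n : ℕ) :
    (a ^ n - b ^ n) * E = ∑ k ∈ Finset.range n, a ^ k * b ^ (n - 1 - k) * (a - b) * E := by
  rw [← geom_sum₂_mul, Finset.sum_mul, Finset.sum_mul]

/-- Telescoping over the `N` groups and inside each group. -/
lemma norm_prod_pow_sub_prod_pow_smul_le (s : ℕ) (n : Fin N → ℕ) (w u β : Fin N → ℝ) {ω W : ℝ}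
    (hω : 0 < ω) (hωw : ∀ i, ω ≤ w i) (hwW : ∀ i, w i ≤ W) (hu : ∀ i, 0 ≤ u i)
    (hu1 : ∀ i, u i ≤ 1) (hnu : ∀ i, 0 < n i * u i) (f g : Fin N → ℤ → ℝ)
    (hf0 : ∀ i k, 0 ≤ f i k) (hf : ∀ i, HasSum (f i) 1) (hfu : ∀ i, u i ≤ overlap (f i))
    (hg0 : ∀ i k, 0 ≤ g i k) (hg : ∀ i, HasSum (g i) 1) (hgu : ∀ i, u i ≤ overlap (g i))
    (hM : ∀ i, ∃ M : ShiftAlg, laurent (shiftUnit (w i)) (f i) - laurent (shiftUnit (w i)) (g i) =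
      ((shiftUnit (w i) : ShiftAlg) - 1) ^ (s + 1) * M ∧ ‖M‖ ≤ β i) :
    ‖(∏ i, laurent (shiftUnit (w i)) (f i) ^ n i - ∏ i, laurent (shiftUnit (w i)) (g i) ^ n i) •
        stepFun‖ ≤
      (4 * √(s + 1)) ^ (s + 1) * (W / ω) * (√(∑ l, n l * u l))⁻¹ *
        ∑ i, n i * β i * (√(n i * u i))⁻¹ ^ s := by
  choose M hM hMn using hM
  set a : Fin N → ShiftAlg := fun i => laurent (shiftUnit (w i)) (f i) with ha
  set b : Fin N → ShiftAlg := fun i => laurent (shiftUnit (w i)) (g i) with hb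
  have h1 : ‖(1 : ShiftAlg)‖ ≤ 1 := norm_one_le_of_zpow (norm_shiftUnit_zpow_le 0)
  have hpow : ∀ (x : ShiftAlg) (k : ℕ), ‖x‖ ≤ 1 → ‖x ^ k‖ ≤ 1 := by
    intro x k hx
    have := norm_prod_le_prod h1 (Finset.range k) (fun _ => x) (fun _ => 1) fun _ _ => hx
    simpa using this
  have han : ∀ i, ‖a i‖ ≤ 1 := fun i =>
    norm_laurent_le_one (norm_shiftUnit_zpow_le _) (hf0 i) (hf i)
  have hbn : ∀ i, ‖b i‖ ≤ 1 := fun i =>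
    norm_laurent_le_one (norm_shiftUnit_zpow_le _) (hg0 i) (hg i)
  set c : Fin N → Fin N → ℤ → ℝ := fun i l => if l < i then g l else f l with hc
  have hc0 : ∀ i l k, 0 ≤ c i l k := by
    intro i l k
    simp only [hc]
    split_ifs
    exacts [hg0 l k, hf0 l k]
  have hcs : ∀ i l, HasSum (c i l) 1 := by
    intro i l
    simp only [hc]
    split_ifs
    exacts [hg l, hf l]
  have hcu : ∀ i l, u l ≤ overlap (c i l) := by
    intro i l
    simp only [hc]
    split_ifs
    exacts [hgu l, hfu l]
  have htel : ∏ i, a i ^ n i - ∏ i, b i ^ n i = ∑ i, (a i ^ n i - b i ^ n i) *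
      ∏ l ∈ Finset.univ.erase i, laurent (shiftUnit (w l)) (c i l) ^ n l := by
    have h := Finset.prod_sub_ordered Finset.univ (fun i => a i ^ n i)
      (fun i => a i ^ n i - b i ^ n i)
    simp only [sub_sub_cancel] at h
    rw [h, sub_sub_cancel]
    refine Finset.sum_congr rfl fun i _ => ?_
    rw [mul_assoc]
    congr 1
    have hite : ∀ l, laurent (shiftUnit (w l)) (c i l) ^ n l =
        if l < i then b l ^ n l else a l ^ n l := by
      intro l
      simp only [hc]
      split_ifs <;> rfl
    rw [Finset.prod_congr rfl fun l _ => hite l, Finset.prod_ite]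
    congr 1
    · refine Finset.prod_congr ?_ fun _ _ => rfl
      ext l
      simp only [Finset.mem_filter, Finset.mem_erase, Finset.mem_univ, true_and, and_true]
      exact ⟨fun h => ⟨h.ne, h⟩, fun h => h.2⟩
    · refine Finset.prod_congr ?_ fun _ _ => rfl
      ext l
      simp only [Finset.mem_filter, Finset.mem_erase, Finset.mem_univ, true_and, and_true, not_lt]
      exact ⟨fun h => ⟨h.ne', h.le⟩, fun h => lt_of_le_of_ne h.2 (Ne.symm h.1)⟩
  rw [htel, Finset.sum_smul, Finset.mul_sum]
  refine (norm_sum_le _ _).trans (Finset.sum_le_sum fun i _ => ?_)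
  set E := ∏ l ∈ Finset.univ.erase i, laurent (shiftUnit (w l)) (c i l) ^ n l with hE
  set κ := (4 * √(s + 1)) ^ (s + 1) * (W / ω) * (√(∑ l, n l * u l))⁻¹ * (√(n i * u i))⁻¹ ^ s
    with hκ
  have hβ : 0 ≤ β i := (norm_nonneg _).trans (hMn i)
  have hterm : ∀ k ∈ Finset.range (n i),
      ‖(a i ^ k * b i ^ (n i - 1 - k) * (a i - b i) * E) • stepFun‖ ≤ β i * κ := by
    intro k hk
    have hk' : k < n i := Finset.mem_range.mp hk
    set v : BddFun := ((shiftUnit (w i) : ShiftAlg) - 1) ^ (s + 1) • stepFun with hv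
    -- the larger of the two powers smooths, the smaller one is a contraction
    obtain ⟨x, y, hx, hxy, hy⟩ : ∃ x y : ShiftAlg, ‖x‖ ≤ 1 ∧
        a i ^ k * b i ^ (n i - 1 - k) = x * y ∧ ‖(y * E) • v‖ ≤ κ := by
      rcases le_total (n i) (2 * k + 1) with h | h
      · exact ⟨b i ^ (n i - 1 - k), a i ^ k, hpow _ _ (hbn i), mul_comm _ _,
          norm_smoothing_le s n w u hω hωw hwW hu hu1 (c i) (hc0 i) (hcs i) (hcu i) i (f i)
            (hf0 i) (hf i) (hfu i) k h (hnu i)⟩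
      · exact ⟨a i ^ k, b i ^ (n i - 1 - k), hpow _ _ (han i), rfl,
          norm_smoothing_le s n w u hω hωw hwW hu hu1 (c i) (hc0 i) (hcs i) (hcu i) i (g i)
            (hg0 i) (hg i) (hgu i) (n i - 1 - k) (by omega) (hnu i)⟩
    have hsplit : (a i ^ k * b i ^ (n i - 1 - k) * (a i - b i) * E) • stepFun =
        (x * M i) • ((y * E) • v) := by
      rw [hxy, hM i, hv]
      simp only [smul_smul]
      congr 1
      ring
    rw [hsplit]
    refine (norm_smul_le _ _).trans (mul_le_mul ?_ hy (norm_nonneg _) hβ)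
    calc ‖x * M i‖ ≤ ‖x‖ * ‖M i‖ := norm_mul_le _ _
      _ ≤ 1 * β i := mul_le_mul hx (hMn i) (norm_nonneg _) zero_le_one
      _ = β i := one_mul _
  rw [pow_sub_pow_mul_eq_sum, Finset.sum_smul]
  refine (norm_sum_le _ _).trans ((Finset.sum_le_sum hterm).trans_eq ?_)
  rw [Finset.sum_const, Finset.card_range, nsmul_eq_mul, hκ]
  ring

end Telescope

/-! ### Laws on the integers -/

/-- The point masses of a measure on `ℤ`. -/
noncomputable def massFun (F : Measure ℤ) (k : ℤ) : ℝ := F.real {k}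

lemma massFun_nonneg (F : Measure ℤ) (k : ℤ) : 0 ≤ massFun F k := measureReal_nonneg

lemma hasSum_massFun (F : Measure ℤ) [IsFiniteMeasure F] : HasSum (massFun F) (F.real Set.univ) := by
  have h : ∑' k : ℤ, F {k} = F Set.univ := by
    have := F.tsum_indicator_apply_singleton Set.univ MeasurableSet.univ
    simpa using this
  have hs : Summable (massFun F) := ENNReal.summable_toReal (h ▸ measure_ne_top F _)
  have ht : ∑' k, massFun F k = F.real Set.univ := by
    rw [measureReal_def, ← h, ENNReal.tsum_toReal_eq fun k => measure_ne_top F _]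
    rfl
  exact ht ▸ hs.hasSum

lemma hasSum_massFun_one (F : Measure ℤ) [IsProbabilityMeasure F] : HasSum (massFun F) 1 := by
  simpa using hasSum_massFun F

lemma shiftDiff_singleton (F : Measure ℤ) [IsFiniteMeasure F] (k : ℤ) :
    shiftDiff F {k} = massFun F (k - 1) - massFun F k := by
  rw [shiftDiff, sub_apply,
    Measure.toSignedMeasure_apply_measurable (MeasurableSet.singleton k),
    Measure.toSignedMeasure_apply_measurable (MeasurableSet.singleton k),
    Measure.conv_dirac, Measure.conv_dirac,
    map_measureReal_apply (by fun_prop) (MeasurableSet.singleton k),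
    map_measureReal_apply (by fun_prop) (MeasurableSet.singleton k), massFun, massFun]
  have h1 : (fun x : ℤ => x + 1) ⁻¹' {k} = {k - 1} := by
    ext j
    simp only [Set.mem_preimage, Set.mem_singleton_iff]
    omega
  have h2 : (fun x : ℤ => x + 0) ⁻¹' {k} = {k} := by
    ext j
    simp
  rw [h1, h2]

lemma HasSum.comp_add_one {f : ℤ → ℝ} {a : ℝ} (h : HasSum f a) : HasSum (fun k => f (k + 1)) a :=
  (Equiv.addRight (1 : ℤ)).hasSum_iff (f := f).mpr h

/-- Half the total variation norm of `F (I₁ - I)` is at least one minus the overlap. -/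
lemma one_sub_tvNorm_shiftDiff_le (F : Measure ℤ) [IsProbabilityMeasure F] :
    1 - tvNorm (shiftDiff F) / 2 ≤ overlap (massFun F) := by
  have hf := hasSum_massFun_one F
  have hf' : HasSum (fun k => massFun F (k + 1)) 1 := hf.comp_add_one
  have htv := hasSum_massFun (shiftDiff F).totalVariation
  have htv' := htv.comp_add_one
  have hle : ∀ k, |massFun F k - massFun F (k + 1)| ≤
      massFun (shiftDiff F).totalVariation (k + 1) := by
    intro k
    have := (shiftDiff F).norm_le_totalVariation {k + 1}
    rwa [shiftDiff_singleton, add_sub_cancel_right, Real.norm_eq_abs] at this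
  have hov := (summable_overlap (massFun_nonneg F) hf.summable).hasSum
  have h := hasSum_le (fun k => ?_) (((hf.add hf').sub htv').mul_left (1 / 2)) hov
  · have htv_def : tvNorm (shiftDiff F) = (shiftDiff F).totalVariation.real Set.univ := rfl
    have hov_def : overlap (massFun F) = ∑' k : ℤ, min (massFun F k) (massFun F (k + 1)) := rfl
    rw [hov_def, htv_def]
    linarith
  · have h2 := abs_le.mp (hle k)
    refine le_min ?_ ?_ <;> linarith

lemma uMin_le_one (F G : Measure ℤ) [IsFiniteMeasure F] [IsFiniteMeasure G] : uMin F G ≤ 1 := by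
  refine (min_le_left _ _).trans ?_
  have : 0 ≤ tvNorm (shiftDiff F) := ENNReal.toReal_nonneg
  linarith

/-! ### Factorial moments -/

section Moments

variable {φ : ℕ → ℤ} {F G : Measure ℤ}

/-- The factorial moment of order `k` along a map `φ` from `ℕ` to `ℤ`; both one-sided
moments are of this form, with `φ m = m` and `φ m = -m`. -/
noncomputable def facMoment (φ : ℕ → ℤ) (k : ℕ) (F : Measure ℤ) : ℝ≥0∞ :=
  ∑' m : ℕ, (m.descFactorial k : ℝ≥0∞) * F {φ m}

lemma facMoment_toReal [IsFiniteMeasure F] (k : ℕ) :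
    (facMoment φ k F).toReal = ∑' m : ℕ, massFun F (φ m) * (m.descFactorial k : ℝ) := by
  rw [facMoment, ENNReal.tsum_toReal_eq fun m =>
    ENNReal.mul_ne_top (ENNReal.natCast_ne_top _) (measure_ne_top F _)]
  refine tsum_congr fun m => ?_
  rw [ENNReal.toReal_mul, ENNReal.toReal_natCast, mul_comm]
  rfl

lemma summable_massFun_mul_descFactorial {s k : ℕ} (hk : k ≤ s) (hF : facMoment φ s F ≠ ∞) :
    Summable fun m : ℕ => massFun F (φ m) * (m.descFactorial k : ℝ) := by
  have h1 : Summable fun m : ℕ => |massFun F (φ m)| * (m.descFactorial s : ℝ) := by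
    refine (ENNReal.summable_toReal hF).congr fun m => ?_
    rw [ENNReal.toReal_mul, ENNReal.toReal_natCast, mul_comm, abs_of_nonneg (massFun_nonneg F _)]
    rfl
  refine ((summable_mul_choose_of_le hk h1).mul_left (k.factorial : ℝ)).congr fun m => ?_
  rw [Nat.descFactorial_eq_factorial_mul_choose]
  push_cast
  ring

lemma tsum_massFun_sub_mul_descFactorial [IsFiniteMeasure F] [IsFiniteMeasure G] {s k : ℕ}
    (hk : k ≤ s) (hF : facMoment φ s F ≠ ∞) (hG : facMoment φ s G ≠ ∞)
    (heq : facMoment φ k F = facMoment φ k G) :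
    ∑' m : ℕ, (massFun F (φ m) - massFun G (φ m)) * (m.descFactorial k : ℝ) = 0 := by
  simp_rw [sub_mul]
  rw [(summable_massFun_mul_descFactorial hk hF).tsum_sub
    (summable_massFun_mul_descFactorial hk hG), ← facMoment_toReal, ← facMoment_toReal, heq,
    sub_self]

lemma abs_massFun_sub_mul_le (s m : ℕ) :
    |massFun F (φ m) - massFun G (φ m)| * (m.descFactorial s : ℝ) ≤
      massFun F (φ m) * (m.descFactorial s : ℝ) + massFun G (φ m) * (m.descFactorial s : ℝ) := by
  rw [← add_mul]
  refine mul_le_mul_of_nonneg_right ?_ (Nat.cast_nonneg _)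
  have h1 := massFun_nonneg F (φ m)
  have h2 := massFun_nonneg G (φ m)
  exact abs_sub_le_iff.mpr ⟨by linarith, by linarith⟩

lemma summable_abs_massFun_sub_mul {s : ℕ} (hF : facMoment φ s F ≠ ∞)
    (hG : facMoment φ s G ≠ ∞) :
    Summable fun m : ℕ => |massFun F (φ m) - massFun G (φ m)| * (m.descFactorial s : ℝ) :=
  Summable.of_nonneg_of_le (fun _ => by positivity) (abs_massFun_sub_mul_le s)
    ((summable_massFun_mul_descFactorial le_rfl hF).add
      (summable_massFun_mul_descFactorial le_rfl hG))

lemma tsum_abs_massFun_sub_mul_le [IsFiniteMeasure F] [IsFiniteMeasure G] {s : ℕ}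
    (hF : facMoment φ s F ≠ ∞) (hG : facMoment φ s G ≠ ∞) :
    ∑' m : ℕ, |massFun F (φ m) - massFun G (φ m)| * (m.descFactorial s : ℝ) ≤
      (facMoment φ s F + facMoment φ s G).toReal := by
  have hF' := summable_massFun_mul_descFactorial le_rfl hF
  have hG' := summable_massFun_mul_descFactorial le_rfl hG
  rw [ENNReal.toReal_add hF hG, facMoment_toReal, facMoment_toReal, ← hF'.tsum_add hG']
  exact (summable_abs_massFun_sub_mul hF hG).tsum_le_tsum (abs_massFun_sub_mul_le s) (hF'.add hG')

end Moments

/-- The factorial moment expansion of the difference of the convolution operators of two laws. -/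
lemma exists_laurent_massFun_sub {F G : Measure ℤ} [IsProbabilityMeasure F]
    [IsProbabilityMeasure G] {s : ℕ}
    (hmom : ∀ k ∈ Finset.Icc 1 s, nuPlus k F = nuPlus k G ∧ nuMinus k F = nuMinus k G)
    (hβ : betaPlus (s + 1) F G + betaMinus (s + 1) F G < ∞) (w : ℝ) :
    ∃ M : ShiftAlg, laurent (shiftUnit w) (massFun F) - laurent (shiftUnit w) (massFun G) =
      ((shiftUnit w : ShiftAlg) - 1) ^ (s + 1) * M ∧
        ‖M‖ ≤ (betaPlus (s + 1) F G + betaMinus (s + 1) F G).toReal := by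
  have hβp : betaPlus (s + 1) F G ≠ ∞ := (le_self_add.trans_lt hβ).ne
  have hβm : betaMinus (s + 1) F G ≠ ∞ := (le_add_self.trans_lt hβ).ne
  have hFp : facMoment (fun m => (m : ℤ)) (s + 1) F ≠ ∞ :=
    ne_top_of_le_ne_top hβp le_self_add
  have hGp : facMoment (fun m => (m : ℤ)) (s + 1) G ≠ ∞ :=
    ne_top_of_le_ne_top hβp le_add_self
  have hFm : facMoment (fun m => -(m : ℤ)) (s + 1) F ≠ ∞ :=
    ne_top_of_le_ne_top hβm le_self_add
  have hGm : facMoment (fun m => -(m : ℤ)) (s + 1) G ≠ ∞ :=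
    ne_top_of_le_ne_top hβm le_add_self
  have hF := hasSum_massFun_one F
  have hG := hasSum_massFun_one G
  have hh : HasSum (fun k => massFun F k - massFun G k) 0 := by simpa using hF.sub hG
  have hle : ∀ k ∈ Finset.Icc 1 s, k ≤ s + 1 := fun k hk =>
    (Finset.mem_Icc.mp hk).2.trans s.le_succ
  obtain ⟨M, hM, hMn⟩ := exists_laurent_sub_laurent (norm_shiftUnit_zpow_le w) hh
    (summable_abs_massFun_sub_mul hFp hGp) (summable_abs_massFun_sub_mul hFm hGm)
    (fun k hk => tsum_massFun_sub_mul_descFactorial (hle k hk) hFp hGp (hmom k hk).1)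
    (fun k hk => tsum_massFun_sub_mul_descFactorial (hle k hk) hFm hGm (hmom k hk).2)
  refine ⟨M, ?_, hMn.trans ?_⟩
  · rw [← hM]
    exact laurent_sub_laurent (norm_shiftUnit_zpow_le w) hF.summable hG.summable
  · rw [ENNReal.toReal_add hβp hβm]
    exact add_le_add (tsum_abs_massFun_sub_mul_le hFp hGp) (tsum_abs_massFun_sub_mul_le hFm hGm)

/-! ### Distribution functions of weighted sums -/

lemma measurable_stepFun : Measurable (stepFun : ℝ → ℝ) :=
  measurable_one.indicator measurableSet_Iic

lemma norm_stepFun_apply_le (x : ℝ) : ‖stepFun x‖ ≤ 1 := by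
  by_cases hx : x ≤ 0 <;> simp [stepFun_apply, hx]

/-- The expectation of a translated step at a weighted sum of independent integer variables is given
by the product of their convolution operators. -/
lemma integral_stepFun_sum {Ω κ : Type*} [MeasurableSpace Ω] {μ : Measure Ω}
    [IsProbabilityMeasure μ] {X : κ → Ω → ℤ} {P : κ → Measure ℤ} [∀ q, IsProbabilityMeasure (P q)]
    (hX : iIndepFun X μ) (hP : ∀ q, HasLaw (X q) (P q) μ) (a : κ → ℝ) (J : Finset κ) (y : ℝ) :
    ∫ ω, stepFun (y + ∑ q ∈ J, a q * (X q ω : ℝ)) ∂μ =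
      ((∏ q ∈ J, laurent (shiftUnit (a q)) (massFun (P q))) • stepFun) y := by
  classical
  have hind : iIndepFun (fun q ω => a q * (X q ω : ℝ)) μ :=
    hX.comp (fun q (k : ℤ) => a q * (k : ℝ)) fun q => by fun_prop
  have hmeas : ∀ q, AEMeasurable (fun ω => a q * (X q ω : ℝ)) μ := fun q =>
    (by fun_prop : Measurable fun k : ℤ => a q * (k : ℝ)).comp_aemeasurable (hP q).aemeasurable
  induction J using Finset.induction_on generalizing y with
  | empty => simp
  | insert q J hq ih =>
    have hS : AEMeasurable (fun ω => ∑ q ∈ J, a q * (X q ω : ℝ)) μ :=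
      Finset.aemeasurable_fun_sum J fun q _ => hmeas q
    have hI : IndepFun (fun ω => a q * (X q ω : ℝ)) (fun ω => ∑ q ∈ J, a q * (X q ω : ℝ)) μ := by
      have := (hind.indepFun_finsetSum_of_notMem₀ hmeas hq).symm
      convert this using 1
      ext ω
      simp
    have hprod := (indepFun_iff_map_prod_eq_prod_map_map (hmeas q) hS).mp hI
    have hmap : μ.map (fun ω => a q * (X q ω : ℝ)) = (P q).map fun k : ℤ => a q * (k : ℝ) := by
      rw [← (hP q).map_eq, AEMeasurable.map_map_of_aemeasurable (by fun_prop) (hP q).aemeasurable]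
      rfl
    have hstep : Measurable fun z : ℝ × ℝ => stepFun (y + (z.1 + z.2)) :=
      measurable_stepFun.comp (by fun_prop)
    have hpm : IsProbabilityMeasure (μ.map fun ω => ∑ q ∈ J, a q * (X q ω : ℝ)) :=
      Measure.isProbabilityMeasure_map hS
    have hpq : IsProbabilityMeasure ((P q).map fun k : ℤ => a q * (k : ℝ)) :=
      Measure.isProbabilityMeasure_map (by fun_prop)
    calc ∫ ω, stepFun (y + ∑ q ∈ insert q J, a q * (X q ω : ℝ)) ∂μ
        = ∫ ω, (fun z : ℝ × ℝ => stepFun (y + (z.1 + z.2)))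
            (a q * (X q ω : ℝ), ∑ q ∈ J, a q * (X q ω : ℝ)) ∂μ := by
          simp_rw [Finset.sum_insert hq]
      _ = ∫ z, stepFun (y + (z.1 + z.2)) ∂((P q).map fun k : ℤ => a q * (k : ℝ)).prod
            (μ.map fun ω => ∑ q ∈ J, a q * (X q ω : ℝ)) := by
          rw [← hmap, ← hprod, integral_map ((hmeas q).prodMk hS) hstep.aestronglyMeasurable]
      _ = ∫ k : ℤ, ∫ ω, stepFun (y + k * a q + ∑ q ∈ J, a q * (X q ω : ℝ)) ∂μ ∂(P q) := by
          rw [integral_prod _ (Integrable.of_bound hstep.aestronglyMeasurable 1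
            (Filter.Eventually.of_forall fun z => norm_stepFun_apply_le _)),
            integral_map (by fun_prop)
              hstep.stronglyMeasurable.integral_prod_right.aestronglyMeasurable]
          refine integral_congr_ae (Filter.Eventually.of_forall fun k => ?_)
          refine (integral_map hS
            (hstep.comp measurable_prodMk_left).aestronglyMeasurable).trans ?_
          refine integral_congr_ae (Filter.Eventually.of_forall fun ω => ?_)
          refine congrArg (fun z : ℝ => stepFun z) ?_
          simp only
          ring
      _ = ∑' k : ℤ, massFun (P q) k *
            ((∏ q ∈ J, laurent (shiftUnit (a q)) (massFun (P q))) • stepFun) (y + k * a q) := by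
          simp_rw [ih]
          rw [integral_countable]
          · rfl
          · refine Integrable.of_bound (Measurable.of_discrete).aestronglyMeasurable
              ‖(∏ q ∈ J, laurent (shiftUnit (a q)) (massFun (P q))) • stepFun‖
              (Filter.Eventually.of_forall fun k => ?_)
            exact lp.norm_apply_le_norm ENNReal.top_ne_zero _ _
      _ = _ := by
          rw [Finset.prod_insert hq]
          refine (laurent_smul_apply _ (hasSum_massFun_one (P q)).summable _ _).symm.trans ?_
          exact congrArg (fun v : BddFun => v y) (mul_smul _ _ _).symm

lemma map_weightedSum_real_Iic {Ω : Type*} [MeasurableSpace Ω] {μ : Measure Ω}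
    [IsProbabilityMeasure μ] {N : ℕ} {n : Fin N → ℕ} (w : Fin N → ℝ) {F : Fin N → Measure ℤ}
    [∀ i, IsProbabilityMeasure (F i)] {X : (i : Fin N) → Fin (n i) → Ω → ℤ}
    (hX : iIndepFun (fun q : Σ i, Fin (n i) => X q.1 q.2) μ)
    (hF : ∀ i j, HasLaw (X i j) (F i) μ) (x : ℝ) :
    (μ.map (weightedSum w X)).real (Set.Iic x) =
      ((∏ i, laurent (shiftUnit (w i)) (massFun (F i)) ^ n i) • stepFun) (-x) := by
  have hsum : ∀ ω, weightedSum w X ω =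
      ∑ q : Σ i, Fin (n i), w q.1 * (X q.1 q.2 ω : ℝ) := by
    intro ω
    rw [weightedSum, Fintype.sum_sigma]
    exact Finset.sum_congr rfl fun i _ => Finset.mul_sum _ _ _
  have hmeas : AEMeasurable (weightedSum w X) μ := by
    have : weightedSum w X = fun ω => ∑ q : Σ i, Fin (n i), w q.1 * (X q.1 q.2 ω : ℝ) :=
      funext hsum
    rw [this]
    refine Finset.aemeasurable_fun_sum _ fun q _ => ?_
    exact (by fun_prop : Measurable fun k : ℤ => w q.1 * (k : ℝ)).comp_aemeasurable
      (hF q.1 q.2).aemeasurable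
  have h := integral_stepFun_sum (P := fun q : Σ i, Fin (n i) => F q.1) hX (fun q => hF q.1 q.2)
    (fun q => w q.1) Finset.univ (-x)
  rw [Fintype.prod_sigma] at h
  simp only [Finset.prod_const, Finset.card_univ, Fintype.card_fin] at h
  rw [← h, ← integral_indicator_one measurableSet_Iic, integral_map hmeas
    (measurable_one.indicator measurableSet_Iic).aestronglyMeasurable]
  refine integral_congr_ae (Filter.Eventually.of_forall fun ω => ?_)
  simp only [stepFun_apply, Set.indicator_apply, Set.mem_Iic, ← hsum ω, Pi.one_apply,
    neg_add_nonpos_iff]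

lemma mul_inv_sqrt_pow_eq_div {n u : ℝ} (hn : 0 < n) (hu : 0 < u) (β : ℝ) (s : ℕ) :
    n * β * (√(n * u))⁻¹ ^ s = β / (n ^ ((s : ℝ) / 2 - 1) * u ^ ((s : ℝ) / 2)) := by
  have h1 : √(n * u) ^ s = n ^ ((s : ℝ) / 2) * u ^ ((s : ℝ) / 2) := by
    rw [← Real.mul_rpow hn.le hu.le, Real.sqrt_eq_rpow, ← Real.rpow_natCast,
      ← Real.rpow_mul (by positivity)]
    congr 1
    ring
  rw [Real.rpow_sub_one hn.ne', inv_pow, h1]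
  have h2 : 0 < n ^ ((s : ℝ) / 2) := Real.rpow_pos_of_pos hn _
  have h3 : 0 < u ^ ((s : ℝ) / 2) := Real.rpow_pos_of_pos hu _
  field_simp

theorem theorem2 (N s : ℕ) (hN : 1 ≤ N) (hs : 1 ≤ s) :
    ∃ C : ℝ, 0 < C ∧
      ∀ {Ω : Type*} [MeasurableSpace Ω] (μ : Measure Ω) [IsProbabilityMeasure μ]
        (n : Fin N → ℕ) (w : Fin N → ℝ)
        (F G : Fin N → Measure ℤ)
        [∀ i, IsProbabilityMeasure (F i)] [∀ i, IsProbabilityMeasure (G i)]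
        (X Z : (i : Fin N) → Fin (n i) → Ω → ℤ),
        -- all the `X i j` and `Z i j` are mutually independent
        iIndepFun (fun p : (Σ i, Fin (n i)) ⊕ (Σ i, Fin (n i)) =>
          Sum.elim (fun q => X q.1 q.2) (fun q => Z q.1 q.2) p) μ →
        (∀ i j, HasLaw (X i j) (F i) μ) →
        (∀ i j, HasLaw (Z i j) (G i) μ) →
        (∀ i, 0 < uMin (F i) (G i)) →
        (∀ i, 1 ≤ (n i : ℝ) * uMin (F i) (G i)) →
        (∀ i, 1 ≤ n i) →
        (∀ i, 0 < w i) →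
        (∀ i, ∀ k ∈ Finset.Icc 1 s,
          nuPlus k (F i) = nuPlus k (G i) ∧ nuMinus k (F i) = nuMinus k (G i)) →
        (∀ i, betaPlus (s + 1) (F i) (G i) + betaMinus (s + 1) (F i) (G i) < ∞) →
        kolmogorovNorm
            ((μ.map (weightedSum w X)).toSignedMeasure -
              (μ.map (weightedSum w Z)).toSignedMeasure) ≤
          C * ((⨆ i, w i) / (⨅ i, w i)) *
            (∑ i, (n i : ℝ) * uMin (F i) (G i)) ^ (-(1 / 2) : ℝ) *
            ∑ i, (betaPlus (s + 1) (F i) (G i) + betaMinus (s + 1) (F i) (G i)).toReal /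
              ((n i : ℝ) ^ ((s : ℝ) / 2 - 1) * uMin (F i) (G i) ^ ((s : ℝ) / 2)) := by

  refine ⟨(4 * √(s + 1)) ^ (s + 1), by positivity, ?_⟩
  intro Ω _ μ _ n w F G _ _ X Z hind hX hZ hu _ hn hw hmom hβ
  have hXi : iIndepFun (fun q : Σ i, Fin (n i) => X q.1 q.2) μ :=
    hind.precomp (g := Sum.inl) Sum.inl_injective
  have hZi : iIndepFun (fun q : Σ i, Fin (n i) => Z q.1 q.2) μ :=
    hind.precomp (g := Sum.inr) Sum.inr_injective
  have hne : Nonempty (Fin N) := ⟨⟨0, hN⟩⟩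
  obtain ⟨i₀, hi₀⟩ := exists_eq_ciInf_of_finite (f := w)
  have hω : 0 < ⨅ i, w i := hi₀ ▸ hw i₀
  have hn0 : ∀ i, (0 : ℝ) < n i := fun i => by exact_mod_cast hn i
  have hnu : ∀ i, 0 < (n i : ℝ) * uMin (F i) (G i) := fun i => mul_pos (hn0 i) (hu i)
  have key := norm_prod_pow_sub_prod_pow_smul_le s n w (fun i => uMin (F i) (G i))
    (fun i => (betaPlus (s + 1) (F i) (G i) + betaMinus (s + 1) (F i) (G i)).toReal) hω
    (fun i => ciInf_le (Set.finite_range w).bddBelow i)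
    (fun i => le_ciSup (Set.finite_range w).bddAbove i)
    (fun i => (hu i).le) (fun i => uMin_le_one _ _) hnu
    (fun i => massFun (F i)) (fun i => massFun (G i))
    (fun i => massFun_nonneg _) (fun i => hasSum_massFun_one _)
    (fun i => (min_le_left _ _).trans (one_sub_tvNorm_shiftDiff_le (F i)))
    (fun i => massFun_nonneg _) (fun i => hasSum_massFun_one _)
    (fun i => (min_le_right _ _).trans (one_sub_tvNorm_shiftDiff_le (G i)))
    (fun i => exists_laurent_massFun_sub (hmom i) (hβ i) (w i))
  have hrhs : (∑ i, (n i : ℝ) * uMin (F i) (G i)) ^ (-(1 / 2) : ℝ) =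
      (√(∑ i, (n i : ℝ) * uMin (F i) (G i)))⁻¹ := by
    rw [Real.rpow_neg (Finset.sum_nonneg fun i _ => (hnu i).le), Real.sqrt_eq_rpow]
  rw [hrhs, ← Finset.sum_congr rfl fun i _ => mul_inv_sqrt_pow_eq_div (hn0 i) (hu i) _ s]
  refine (ciSup_le fun x => ?_).trans key
  rw [sub_apply, Measure.toSignedMeasure_apply_measurable measurableSet_Iic,
    Measure.toSignedMeasure_apply_measurable measurableSet_Iic,
    map_weightedSum_real_Iic w hXi hX, map_weightedSum_real_Iic w hZi hZ]
  refine le_trans (le_of_eq ?_) (lp.norm_apply_le_norm ENNReal.top_ne_zero _ (-x))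
  rw [sub_smul, Real.norm_eq_abs]
  rfl
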